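/- **Lemma (Local structure of $BV$-derivatives).** Let $\Omega\subset\mathbb R^d$ be open, let $u\in \mathrm{BV}(\Omega;\mathbb R^m)$ (that is, $u\in L^1(\Omega;\mathbb R^m)$ and its distributional derivative $Du$ is a finite $\mathbb R^{m\times d}$-valued Borel measure on $\Omega$, extended by zero to $\mathbb R^d$), and let $C\subset\mathbb R^d$ be a bounded open convex set containing the origin. Write $C(x_0,r):=x_0+rC$, and let $|Du|$ be the total variation measure of $Du$ with respect to the Frobenius norm on $\mathbb R^{m\times d}$. For $x_0\in\operatorname{supp}Du$ (the support being taken in $\Omega$), let $\mathrm{Tan}_C(Du,x_0)$ be the set of all finite $\mathbb R^{m\times d}$-valued Borel measures $\tau$ on $C$ for which there are radii $r_n>0$, $r_n\to0$, such that the restrictions to $C$ of the measures $$|Du|(C(x_0,r_n))^{-1}\,T^{(x_0,r_n)}_*Du,\qquad T^{(x_0,r)}(x):=\frac{x-x_0}{r},$$ converge to $\tau$ weakly* (in duality with $C_0(C)$). Then for every $x_0\in\operatorname{supp}Du$ each $\tau\in\mathrm{Tan}_C(Du,x_0)$ is a $\mathrm{BV}$-derivative: $\tau=Dv$ for some $v\in\mathrm{BV}(C;\mathbb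 R^m)$. Moreover, if the polar of $Du$ exists at $x_0$, i.e. if the limit $$P_0:=\frac{\mathrm dDu}{\mathrm d|Du|}(x_0)=\lim_{r\downarrow0}\frac{Du(C(x_0,r))}{|Du|(C(x_0,r))}$$ exists and has Frobenius norm $|P_0|=1$, then every $v\in\mathrm{BV}(C;\mathbb R^m)$ with $Dv=\tau$ satisfies: 1. If $\operatorname{rank}P_0\ge2$, then there are $\alpha\in\mathbb R$ and $v_0\in\mathbb R^m$ such that $v(x)=v_0+\alpha P_0x$ for a.e. $x\in C$. 2. If $P_0=a\otimes\xi:=a\xi^T$ with $a\in\mathbb R^m$, $\xi\in\mathbb R^d$, $|\xi|=1$, then there are $v_0\in\mathbb R^m$ and a function $\psi:\mathbb R\to\mathbb R$ which has bounded variation on every compact subinterval of the open interval $I:=\{x\cdot\xi : x\in C\}$, such that $v(x)=v_0+\psi(x\cdot\xi)\,a$ for a.e. $x\in C$. -/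

import Mathlib

open MeasureTheory Set Filter Topology
open scoped ZeroAtInfty ContDiff

/-- A matrix as an element of `ℝ^(m × d)` with the Euclidean norm, which is the Frobenius norm. -/
noncomputable def matVec {m d : ℕ} (A : Matrix (Fin m) (Fin d) ℝ) :
    EuclideanSpace ℝ (Fin m × Fin d) :=
  WithLp.toLp 2 fun p ↦ A p.1 p.2

/-- Finite Borel measures on `ℝ^d` with values in the `m × d` matrices, normed by the Frobenius
norm (a countably additive set function with values in a finite-dimensional space has finite total
variation). A finite measure on a Borel set `A` is represented by its extension by zero, i.e. by a
`μ` with `μ.restrict A = μ`. -/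
abbrev MatMeasure (m d : ℕ) : Type :=
  VectorMeasure (EuclideanSpace ℝ (Fin d)) (EuclideanSpace ℝ (Fin m × Fin d))

/-- `u ∈ BV(Ω; ℝ^m)` with distributional derivative `Du = μ`: the function `u` is integrable on `Ω`,
`μ` is a finite matrix-valued measure on `Ω`, and
`∫_Ω u^i ∂_j φ dx = - ∫ φ dμ^i_j` for all test functions `φ ∈ C_c^∞(Ω)`. -/
structure HasBVDeriv {m d : ℕ} (Ω : Set (EuclideanSpace ℝ (Fin d)))
    (u : EuclideanSpace ℝ (Fin d) → EuclideanSpace ℝ (Fin m)) (μ : MatMeasure m d) : Prop where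
  integrableOn : IntegrableOn u Ω volume
  restrict_eq : μ.restrict Ω = μ
  integral_eq : ∀ φ : EuclideanSpace ℝ (Fin d) → ℝ, ContDiff ℝ ∞ φ → HasCompactSupport φ →
    tsupport φ ⊆ Ω → ∀ (i : Fin m) (j : Fin d),
      ∫ x in Ω, u x i * fderiv ℝ φ x (EuclideanSpace.single j 1) = -((∫ᵛ x, φ x ∂•μ) (i, j))

/-- The set `C(x₀, r) = x₀ + r C`. -/
def scaledCopy {d : ℕ} (C : Set (EuclideanSpace ℝ (Fin d))) (x₀ : EuclideanSpace ℝ (Fin d))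
    (r : ℝ) : Set (EuclideanSpace ℝ (Fin d)) :=
  (fun y ↦ x₀ + r • y) '' C

/-- The rescaled measure `|μ|(C(x₀, r))⁻¹ T_* μ`, restricted to `C`, where
`T x = (x - x₀) / r`. -/
noncomputable def blowUp {m d : ℕ} (μ : MatMeasure m d) (C : Set (EuclideanSpace ℝ (Fin d)))
    (x₀ : EuclideanSpace ℝ (Fin d)) (r : ℝ) : MatMeasure m d :=
  (μ.variation.real (scaledCopy C x₀ r))⁻¹ • (μ.map (fun x ↦ r⁻¹ • (x - x₀))).restrict C

/-- Weak* convergence of finite measures on an open set `C`, that is, in duality with `C₀(C)`, the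
continuous functions on `ℝ^d` that vanish outside `C` and at infinity. -/
def WeakStarTendsto {m d : ℕ} (C : Set (EuclideanSpace ℝ (Fin d))) (γ : ℕ → MatMeasure m d)
    (τ : MatMeasure m d) : Prop :=
  ∀ φ : C₀(EuclideanSpace ℝ (Fin d), ℝ), (∀ x, x ∉ C → φ x = 0) →
    Tendsto (fun n ↦ ∫ᵛ x, φ x ∂•(γ n)) atTop (𝓝 (∫ᵛ x, φ x ∂•τ))

/-- `Tan_C(μ, x₀)`: the weak* limits, as finite measures on `C`, of blow-up sequences of `μ` at `x₀`
along radii `r_n ↓ 0`. -/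
def tangentMeasures {m d : ℕ} (C : Set (EuclideanSpace ℝ (Fin d))) (μ : MatMeasure m d)
    (x₀ : EuclideanSpace ℝ (Fin d)) : Set (MatMeasure m d) :=
  {τ | τ.restrict C = τ ∧ ∃ r : ℕ → ℝ, (∀ n, 0 < r n) ∧ Tendsto r atTop (𝓝 0) ∧
    WeakStarTendsto C (fun n ↦ blowUp μ C x₀ (r n)) τ}

/-- The polar `dμ/d|μ|` exists at `x₀` as a limit along the sets `C(x₀, r)`, `r ↓ 0`, and equals
`P`. As a value of a polar, `P` lies in the unit sphere. -/
def HasPolarAt {m d : ℕ} (C : Set (EuclideanSpace ℝ (Fin d))) (μ : MatMeasure m d)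
    (x₀ : EuclideanSpace ℝ (Fin d)) (P : Matrix (Fin m) (Fin d) ℝ) : Prop :=
  ‖matVec P‖ = 1 ∧ Tendsto (fun r : ℝ ↦
    (μ.variation.real (scaledCopy C x₀ r))⁻¹ • μ (scaledCopy C x₀ r)) (𝓝[>] 0) (𝓝 (matVec P))

/-! Existence. The blow-ups of `Du` are derivatives of rescaled copies of `u`, with mass at most one
on `C`. Strong compactness is obtained by hand, without extension or trace theorems. A convex `C`
containing a ball of radius `ρ` about 0 is mapped into itself by `x ↦ (1 - s) x`, with room `s ρ` to
spare, so contracting and then mollifying at that scale gives smooth functions on all of `C`. The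
`L¹(C)` error is `O(s)` with a constant depending only on `C` and the mass
(`HasWeakGrad.setLIntegral_dilMollify_sub_le`). For fixed `s` the gradients of the smoothed
functions are the derivative measures tested against fixed kernels, so weak* convergence makes them
converge pointwise, and integrating along rays from 0 makes the functions converge up to constants.
Hence the rescaled functions are Cauchy in `L¹(C)` modulo constants, and the limit has derivative
`τ` (`exists_integral_mul_fderiv_eq_of_tendsto`).

Structure. The blow-ups have mass at most one and total value tending to a unit vector `P₀`, which
leaves no room for cancellation: tested against a nonnegative function, the limit `τ` gives a
nonnegative multiple of `P₀` (`integral_eq_norm_smul_of_hasPolarAt`). The smoothings of `v`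
therefore have gradient `G P₀` with `G ≥ 0`. If the rank is at least two, symmetry of second
derivatives forces `G` to be constant; if `P₀ = a ⊗ ξ`, each smoothing is a constant plus an
increasing function of `x · ξ` times `a`. Both forms survive almost everywhere limits
(`ae_eq_affine_of_tendsto`, `ae_eq_smul_of_tendsto`). -/

open Metric ContinuousLinearMap
open scoped Convolution ENNReal

/-! ### Mollification of functions with weak gradients, and homotheties of a convex set. -/

section Mollification

variable {E : Type*} [NormedAddCommGroup E] [InnerProductSpace ℝ E] [FiniteDimensional ℝ E]
  [MeasurableSpace E] [BorelSpace E]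

/-- The integrable function `g` has on the open set `C` the weak directional derivatives
`e ↦ L e`, functionals on test functions that are dominated by the measure `κ`. -/
structure HasWeakGrad (C : Set E) (g : E → ℝ) (L : E → (E → ℝ) → ℝ) (κ : Measure E) : Prop where
  stronglyMeasurable : StronglyMeasurable g
  integrable : Integrable g
  integral_eq : ∀ φ : E → ℝ, ContDiff ℝ ∞ φ → HasCompactSupport φ → tsupport φ ⊆ C →
    ∀ e, ∫ x, g x * fderiv ℝ φ x e = -L e φ
  bound : ∀ e φ, |L e φ| ≤ ‖e‖ * ∫ x, |φ x| ∂κ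

/-- Convolution of `g` with the normalized bump function `b`. -/
noncomputable def mollify (b : ContDiffBump (0 : E)) (g : E → ℝ) : E → ℝ :=
  b.normed volume ⋆[lsmul ℝ ℝ, volume] g

lemma contDiff_mollify (b : ContDiffBump (0 : E)) {g : E → ℝ} (hg : Integrable g) :
    ContDiff ℝ ∞ (mollify b g) :=
  b.hasCompactSupport_normed.contDiff_convolution_left _ b.contDiff_normed hg.locallyIntegrable

lemma mollify_apply_swap (b : ContDiffBump (0 : E)) (g : E → ℝ) (w : E) :
    mollify b g w = ∫ t, b.normed volume (w - t) * g t := by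
  rw [mollify, convolution_eq_swap]; rfl

lemma contDiff_normed_sub_left (b : ContDiffBump (0 : E)) (w : E) :
    ContDiff ℝ ∞ fun t ↦ b.normed volume (w - t) :=
  b.contDiff_normed.comp (contDiff_const.sub contDiff_id)

lemma tsupport_normed_sub_left (b : ContDiffBump (0 : E)) (w : E) :
    tsupport (fun t ↦ b.normed volume (w - t)) ⊆ closedBall w b.rOut := by
  refine closure_minimal (fun t ht ↦ ?_) isClosed_closedBall
  have : w - t ∈ Function.support (b.normed volume) := ht
  rw [b.support_normed_eq, mem_ball, dist_zero_right] at this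
  rw [mem_closedBall, dist_comm, dist_eq_norm]; exact this.le

lemma hasCompactSupport_normed_sub_left (b : ContDiffBump (0 : E)) (w : E) :
    HasCompactSupport fun t ↦ b.normed volume (w - t) :=
  (isCompact_closedBall w b.rOut).of_isClosed_subset (isClosed_tsupport _)
    (tsupport_normed_sub_left b w)

/-- The reflected kernel `t ↦ k (w - t)` is an admissible test function because its support lies in
the ball about `w`; the sign from the reflection cancels the one from integration by parts. -/
lemma HasWeakGrad.fderiv_mollify {C : Set E} {g : E → ℝ} {L : E → (E → ℝ) → ℝ} {κ : Measure E}
    (h : HasWeakGrad C g L κ) (b : ContDiffBump (0 : E)) {w : E} (hw : closedBall w b.rOut ⊆ C)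
    (e : E) : fderiv ℝ (mollify b g) w e = L e (fun t ↦ b.normed volume (w - t)) := by
  have hk1 : ContDiff ℝ 1 (b.normed volume : E → ℝ) := b.contDiff_normed
  have h1 := (b.hasCompactSupport_normed (μ := volume)).hasFDerivAt_convolution_left
    (lsmul ℝ ℝ) hk1 h.integrable.locallyIntegrable w
  have h2 := h.integral_eq _ (contDiff_normed_sub_left b w)
    (hasCompactSupport_normed_sub_left b w) ((tsupport_normed_sub_left b w).trans hw) e
  have h3 : ∀ t, fderiv ℝ (fun t ↦ b.normed volume (w - t)) t e
      = -(fderiv ℝ (b.normed volume) (w - t) e) := by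
    intro t
    have := ((hk1.differentiable one_ne_zero (w - t)).hasFDerivAt).comp t
      ((hasFDerivAt_id t).const_sub w)
    have h4 : HasFDerivAt (fun t ↦ b.normed volume (w - t)) _ t := this
    rw [h4.fderiv]; simp
  rw [mollify, h1.fderiv, convolution_eq_swap]
  rw [ContinuousLinearMap.integral_apply]
  · simp only [h3, mul_neg, integral_neg, neg_inj] at h2
    rw [← h2]
    congr 1 with t
    simp [precompL_apply, mul_comm]
  · have := (b.hasCompactSupport_normed (μ := volume) |>.fderiv ℝ).convolutionExists_left
      ((lsmul ℝ ℝ : ℝ →L[ℝ] ℝ →L[ℝ] ℝ).precompL E) (hk1.continuous_fderiv one_ne_zero)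
      h.integrable.locallyIntegrable w
    exact this.integrable_swap

/-! ### Homotheties -/

lemma lintegral_comp_smul_add {f : E → ℝ≥0∞} (hf : Measurable f) {a : ℝ} (ha : a ≠ 0) (z : E) :
    ∫⁻ x, f (a • x + z) = ENNReal.ofReal |(a ^ Module.finrank ℝ E)⁻¹| * ∫⁻ x, f x := by
  have h1 : ∫⁻ x, f (a • x + z) = ∫⁻ x, f (x + z) ∂(Measure.map (a • ·) volume) :=
    (lintegral_map (f := fun x ↦ f (x + z)) (hf.comp (measurable_add_const z))
      (measurable_const_smul a)).symm
  rw [h1, Measure.map_addHaar_smul _ ha, lintegral_smul_measure, lintegral_add_right_eq_self]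
  rfl

lemma quasiMeasurePreserving_smul_add {a : ℝ} (ha : a ≠ 0) (z : E) :
    Measure.QuasiMeasurePreserving (fun x : E ↦ a • x + z) := by
  have hm : Measurable (fun x : E ↦ a • x + z) := by fun_prop
  refine ⟨hm, Measure.AbsolutelyContinuous.mk fun s hs h0 ↦ ?_⟩
  rw [Measure.map_apply hm hs, ← lintegral_indicator_one (hm hs)]
  have := lintegral_comp_smul_add (measurable_one.indicator hs : Measurable (s.indicator
    (1 : E → ℝ≥0∞))) ha z
  rw [lintegral_indicator_one hs, h0, mul_zero] at this
  exact this

lemma ofReal_abs_inv_pow_le {a : ℝ} (ha : 1 / 2 ≤ a) (n : ℕ) :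
    ENNReal.ofReal |(a ^ n)⁻¹| ≤ 2 ^ n := by
  have h0 : 0 < a := by linarith
  rw [abs_of_nonneg (by positivity), ← ENNReal.ofReal_ofNat, ← ENNReal.ofReal_pow (by norm_num)]
  refine ENNReal.ofReal_le_ofReal ?_
  rw [← inv_pow]
  refine pow_le_pow_left₀ (by positivity) ?_ n
  rw [inv_le_comm₀ h0 (by norm_num)]; linarith

lemma setLIntegral_comp_smul_add_le {C : Set E} (hC : MeasurableSet C) {f : E → ℝ≥0∞}
    (hf : Measurable f) {a : ℝ} (ha : 1 / 2 ≤ a) {z : E} (hz : ∀ x ∈ C, a • x + z ∈ C) :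
    ∫⁻ x in C, f (a • x + z) ≤ 2 ^ Module.finrank ℝ E * ∫⁻ x in C, f x := by
  calc ∫⁻ x in C, f (a • x + z) = ∫⁻ x in C, C.indicator f (a • x + z) := by
        refine setLIntegral_congr_fun hC fun x hx ↦ ?_
        simp [indicator_of_mem (hz x hx)]
    _ ≤ ∫⁻ x, C.indicator f (a • x + z) := setLIntegral_le_lintegral _ _
    _ = ENNReal.ofReal |(a ^ Module.finrank ℝ E)⁻¹| * ∫⁻ x, C.indicator f x :=
        lintegral_comp_smul_add (hf.indicator hC) (by linarith) z
    _ ≤ _ := by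
        rw [lintegral_indicator hC]
        gcongr
        exact ofReal_abs_inv_pow_le ha _

/-- Fundamental theorem of calculus along the segment from `x` towards `y`, then Tonelli. Each
intermediate homothety has ratio at least 1/2 and maps `C` into itself, so undoing it costs at most
a factor `2 ^ dim`. -/
lemma setLIntegral_sub_homothety_le {C : Set E} (hCo : IsOpen C) (hCc : Convex ℝ C) {F : E → ℝ}
    (hF : ContDiff ℝ 1 F) {D : ℝ} (hD : ∀ x ∈ C, ∀ y ∈ C, ‖y - x‖ ≤ D) {s : ℝ} (hs0 : 0 ≤ s)
    (hs : s ≤ 1 / 2) {y : E} (hy : y ∈ C) :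
    ∫⁻ x in C, ‖F ((1 - s) • x + s • y) - F x‖ₑ ≤
      ENNReal.ofReal (s * D) * 2 ^ Module.finrank ℝ E * ∫⁻ x in C, ‖fderiv ℝ F x‖ₑ := by
  have hFc : Continuous (fderiv ℝ F) := hF.continuous_fderiv one_ne_zero
  have hD0 : 0 ≤ D := (norm_nonneg _).trans (hD y hy y hy)
  have key : ∀ x ∈ C, ‖F ((1 - s) • x + s • y) - F x‖ₑ ≤
      ∫⁻ r in Ioc 0 s, ENNReal.ofReal D * ‖fderiv ℝ F ((1 - r) • x + r • y)‖ₑ := by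
    intro x hx
    have hd : ∀ r : ℝ, HasDerivAt (fun r : ℝ ↦ F ((1 - r) • x + r • y))
        (fderiv ℝ F ((1 - r) • x + r • y) (y - x)) r := by
      intro r
      have h1 : HasDerivAt (fun r : ℝ ↦ (1 - r) • x + r • y) (y - x) r := by
        have := (((hasDerivAt_id r).const_sub 1).smul_const x).add
          ((hasDerivAt_id r).smul_const y)
        refine this.congr_deriv ?_
        simp; abel
      exact ((hF.differentiable one_ne_zero _).hasFDerivAt).comp_hasDerivAt r h1
    have hc : Continuous fun r : ℝ ↦ fderiv ℝ F ((1 - r) • x + r • y) (y - x) :=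
      (hFc.comp (by fun_prop)).clm_apply continuous_const
    have h2 := intervalIntegral.integral_eq_sub_of_hasDerivAt (a := 0) (b := s)
      (fun r _ ↦ hd r) (hc.intervalIntegrable 0 s)
    simp only [sub_zero, one_smul, zero_smul, add_zero] at h2
    rw [← h2, intervalIntegral.integral_of_le hs0]
    refine (enorm_integral_le_lintegral_enorm _).trans (lintegral_mono fun r ↦ ?_)
    rw [mul_comm]
    refine (ContinuousLinearMap.le_opENorm _ _).trans ?_
    gcongr
    rw [← ofReal_norm]
    exact ENNReal.ofReal_le_ofReal (hD x hx y hy)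
  calc ∫⁻ x in C, ‖F ((1 - s) • x + s • y) - F x‖ₑ
      ≤ ∫⁻ x in C, ∫⁻ r in Ioc 0 s, ENNReal.ofReal D * ‖fderiv ℝ F ((1 - r) • x + r • y)‖ₑ :=
        setLIntegral_mono' hCo.measurableSet key
    _ = ∫⁻ r in Ioc 0 s, ∫⁻ x in C, ENNReal.ofReal D * ‖fderiv ℝ F ((1 - r) • x + r • y)‖ₑ := by
        refine lintegral_lintegral_swap (Measurable.aemeasurable ?_)
        refine Continuous.measurable ?_ |>.enorm |>.const_mul _
        exact hFc.comp (by fun_prop)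
    _ ≤ ∫⁻ r in Ioc 0 s, ENNReal.ofReal D *
          (2 ^ Module.finrank ℝ E * ∫⁻ x in C, ‖fderiv ℝ F x‖ₑ) := by
        refine setLIntegral_mono' measurableSet_Ioc fun r hr ↦ ?_
        rw [lintegral_const_mul _ (by
          exact (hFc.comp (by fun_prop)).measurable.enorm)]
        gcongr
        refine setLIntegral_comp_smul_add_le hCo.measurableSet
          (f := fun x ↦ ‖fderiv ℝ F x‖ₑ) hFc.measurable.enorm
          (by linarith [hr.2]) fun x hx ↦ ?_
        exact hCc hx hy (by linarith [hr.2]) hr.1.le (by ring)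
    _ = _ := by
        rw [setLIntegral_const, Real.volume_Ioc, sub_zero, mul_comm s D, ENNReal.ofReal_mul hD0]
        ring

end Mollification

/-! ### Contracting before mollifying: smoothing up to the boundary of a convex set. -/

section Dilation

variable {E : Type*} [NormedAddCommGroup E] [InnerProductSpace ℝ E] [FiniteDimensional ℝ E]
  [MeasurableSpace E] [BorelSpace E]

/-- Mollification of `g`, precomposed with the contraction `x ↦ (1 - s) x`. On a convex set this
is smooth up to the boundary although `g` is only given on that set. -/
noncomputable def dilMollify (b : ContDiffBump (0 : E)) (s : ℝ) (g : E → ℝ) (x : E) : ℝ :=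
  mollify b g ((1 - s) • x)

lemma contDiff_dilMollify (b : ContDiffBump (0 : E)) (s : ℝ) {g : E → ℝ} (hg : Integrable g) :
    ContDiff ℝ ∞ (dilMollify b s g) :=
  (contDiff_mollify b hg).comp (contDiff_const_smul _)

omit [FiniteDimensional ℝ E] [MeasurableSpace E] [BorelSpace E] in
-- A point `z` of the small ball is the convex combination of `x` and `(z - (1 - s) x) / s`, and the
-- latter has norm at most `ρ`.
lemma Convex.closedBall_smul_subset {C : Set E} (hCc : Convex ℝ C) {ρ s r : ℝ}
    (hρ : closedBall 0 ρ ⊆ C) (hs0 : 0 < s) (hs1 : s ≤ 1) (hr : r ≤ s * ρ) {x : E} (hx : x ∈ C) :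
    closedBall ((1 - s) • x) r ⊆ C := by
  intro z hz
  have hy : s⁻¹ • (z - (1 - s) • x) ∈ C := by
    refine hρ ?_
    rw [mem_closedBall, dist_zero_right, norm_smul, norm_inv, Real.norm_of_nonneg hs0.le,
      inv_mul_le_iff₀ hs0, ← dist_eq_norm]
    exact (mem_closedBall.1 hz).trans hr
  have := hCc hx hy (by linarith : 0 ≤ 1 - s) hs0.le (by ring)
  rwa [smul_smul, mul_inv_cancel₀ hs0.ne', one_smul, add_sub_cancel] at this

variable {C : Set E} {g : E → ℝ} {L : E → (E → ℝ) → ℝ} {κ : Measure E}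

lemma HasWeakGrad.fderiv_dilMollify (h : HasWeakGrad C g L κ) (b : ContDiffBump (0 : E)) (s : ℝ)
    {x : E} (hx : closedBall ((1 - s) • x) b.rOut ⊆ C) (e : E) :
    fderiv ℝ (dilMollify b s g) x e =
      (1 - s) * L e (fun t ↦ b.normed volume ((1 - s) • x - t)) := by
  have h1 := ((contDiff_mollify b h.integrable).differentiable (by simp)
    ((1 - s) • x)).hasFDerivAt.comp x ((hasFDerivAt_id x).const_smul (1 - s))
  have h2 : HasFDerivAt (dilMollify b s g) _ x := h1
  rw [h2.fderiv, ← h.fderiv_mollify b hx]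
  simp

lemma integrable_normed_sub_left [IsFiniteMeasure κ] (b : ContDiffBump (0 : E)) (w : E) :
    Integrable (fun t ↦ b.normed volume (w - t)) κ :=
  (contDiff_normed_sub_left b w).continuous.integrable_of_hasCompactSupport
    (hasCompactSupport_normed_sub_left b w)

lemma HasWeakGrad.enorm_fderiv_dilMollify_le [IsFiniteMeasure κ] (h : HasWeakGrad C g L κ)
    (b : ContDiffBump (0 : E)) {s : ℝ} (hs0 : 0 ≤ s) (hs1 : s ≤ 1)
    {x : E} (hx : closedBall ((1 - s) • x) b.rOut ⊆ C) :
    ‖fderiv ℝ (dilMollify b s g) x‖ₑ ≤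
      ∫⁻ t, ENNReal.ofReal (b.normed volume ((1 - s) • x - t)) ∂κ := by
  rw [← ofReal_integral_eq_lintegral_ofReal (integrable_normed_sub_left b _)
    (Eventually.of_forall fun t ↦ b.nonneg_normed _), ← ofReal_norm]
  refine ENNReal.ofReal_le_ofReal ?_
  refine ContinuousLinearMap.opNorm_le_bound _
    (integral_nonneg fun t ↦ b.nonneg_normed _) fun e ↦ ?_
  rw [h.fderiv_dilMollify b s hx, norm_mul, Real.norm_of_nonneg (by linarith : 0 ≤ 1 - s)]
  have := h.bound e (fun t ↦ b.normed volume ((1 - s) • x - t))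
  simp only [abs_of_nonneg (b.nonneg_normed _)] at this
  calc (1 - s) * ‖L e fun t ↦ b.normed volume ((1 - s) • x - t)‖
      ≤ 1 * ‖L e fun t ↦ b.normed volume ((1 - s) • x - t)‖ := by gcongr; linarith
    _ ≤ _ := by rw [one_mul, mul_comm]; exact this

lemma lintegral_ofReal_normed (b : ContDiffBump (0 : E)) :
    ∫⁻ t, ENNReal.ofReal (b.normed volume t) = 1 := by
  rw [← ofReal_integral_eq_lintegral_ofReal b.integrable_normed
    (Eventually.of_forall b.nonneg_normed), b.integral_normed, ENNReal.ofReal_one]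

/-- By Tonelli the kernel is integrated in `x` first; it has integral one, up to the Jacobian of the
contraction. The bound depends neither on the bump nor on `s`. -/
lemma HasWeakGrad.setLIntegral_fderiv_dilMollify_le [IsFiniteMeasure κ] (h : HasWeakGrad C g L κ)
    (hCo : IsOpen C) (hCc : Convex ℝ C) {ρ s : ℝ} (hρ : closedBall 0 ρ ⊆ C)
    (b : ContDiffBump (0 : E)) (hs0 : 0 < s) (hs : s ≤ 1 / 2) (hb : b.rOut ≤ s * ρ) :
    ∫⁻ x in C, ‖fderiv ℝ (dilMollify b s g) x‖ₑ ≤ 2 ^ Module.finrank ℝ E * κ univ := by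
  have hk : Continuous (b.normed volume) := b.continuous_normed
  calc ∫⁻ x in C, ‖fderiv ℝ (dilMollify b s g) x‖ₑ
      ≤ ∫⁻ x in C, ∫⁻ t, ENNReal.ofReal (b.normed volume ((1 - s) • x - t)) ∂κ :=
        setLIntegral_mono' hCo.measurableSet fun x hx ↦
          h.enorm_fderiv_dilMollify_le b hs0.le (by linarith)
            (hCc.closedBall_smul_subset hρ hs0 (by linarith) hb hx)
    _ ≤ ∫⁻ x, ∫⁻ t, ENNReal.ofReal (b.normed volume ((1 - s) • x - t)) ∂κ :=
        setLIntegral_le_lintegral _ _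
    _ = ∫⁻ t, (∫⁻ x, ENNReal.ofReal (b.normed volume ((1 - s) • x - t))) ∂κ := by
        refine lintegral_lintegral_swap (Measurable.aemeasurable ?_)
        exact (hk.comp (by fun_prop)).measurable.ennreal_ofReal
    _ ≤ ∫⁻ t, 2 ^ Module.finrank ℝ E ∂κ := by
        refine lintegral_mono fun t ↦ ?_
        have := lintegral_comp_smul_add (f := fun x ↦ ENNReal.ofReal (b.normed volume x))
          hk.measurable.ennreal_ofReal (by linarith : 1 - s ≠ 0) (-t)
        simp only [← sub_eq_add_neg] at this
        rw [this, lintegral_ofReal_normed, mul_one]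
        exact ofReal_abs_inv_pow_le (by linarith) _
    _ = _ := by rw [lintegral_const]

/-- The radii of the standard sequence of bumps. -/
noncomputable def dilStep (n : ℕ) : ℝ := 1 / ((n : ℝ) + 2)

lemma dilStep_pos (n : ℕ) : 0 < dilStep n := by unfold dilStep; positivity

lemma dilStep_le (n : ℕ) : dilStep n ≤ 1 / 2 := by
  unfold dilStep
  exact one_div_le_one_div_of_le (by norm_num) (by linarith [n.cast_nonneg (α := ℝ)])

lemma tendsto_dilStep : Tendsto dilStep atTop (𝓝 0) :=
  tendsto_const_nhds.div_atTop
    (tendsto_atTop_add_const_right _ _ tendsto_natCast_atTop_atTop)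

/-- Bumps at the origin whose radii are `ρ` times the standard step size. -/
noncomputable def dilBump (E : Type*) [NormedAddCommGroup E] [InnerProductSpace ℝ E]
    {ρ : ℝ} (hρ : 0 < ρ) (n : ℕ) : ContDiffBump (0 : E) where
  rIn := dilStep n * ρ / 2
  rOut := dilStep n * ρ
  rIn_pos := by have := dilStep_pos n; positivity
  rIn_lt_rOut := by have := mul_pos (dilStep_pos n) hρ; linarith

/-- With outer radius at most twice the inner one, the kernel is at most `2 ^ dim` divided by the
volume of its ball, so mollification is controlled by plain averages. -/
lemma abs_mollify_sub_le (b : ContDiffBump (0 : E)) (hb : b.rOut ≤ 2 * b.rIn) (hg : Integrable g)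
    (w : E) (c : ℝ) :
    |mollify b g w - c| ≤
      2 ^ Module.finrank ℝ E * ⨍ t in closedBall w b.rOut, ‖g t - c‖ := by
  have hk : Continuous (fun t ↦ b.normed volume (w - t)) :=
    (contDiff_normed_sub_left b w).continuous
  have hi1 : Integrable (fun t ↦ b.normed volume (w - t) * g t) := by
    have := (b.hasCompactSupport_normed (μ := volume)).convolutionExists_left
      (lsmul ℝ ℝ) b.continuous_normed hg.locallyIntegrable w
    exact this.integrable_swap
  have hi2 : Integrable (fun t ↦ b.normed volume (w - t) * c) :=
    (hk.integrable_of_hasCompactSupport (hasCompactSupport_normed_sub_left b w)).mul_const c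
  have h1 : ∫ t, b.normed volume (w - t) * c = c := by
    rw [integral_mul_const, integral_sub_left_eq_self (fun t ↦ b.normed volume t) volume w,
      b.integral_normed, one_mul]
  have h2 : mollify b g w - c = ∫ t, b.normed volume (w - t) * (g t - c) := by
    simp only [mul_sub]
    rw [integral_sub hi1 hi2, h1, mollify_apply_swap]
  have hV : 0 < volume.real (closedBall w b.rOut) :=
    ENNReal.toReal_pos (measure_closedBall_pos _ _ b.rOut_pos).ne' measure_closedBall_lt_top.ne
  have hgi : IntegrableOn (fun t ↦ ‖g t - c‖) (closedBall w b.rOut) :=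
    (hg.integrableOn.sub (integrableOn_const measure_closedBall_lt_top.ne)).norm
  have h3 : ∀ t, ‖b.normed volume (w - t) * (g t - c)‖ ≤ (closedBall w b.rOut).indicator
      (fun t ↦ 2 ^ Module.finrank ℝ E / volume.real (closedBall w b.rOut) * ‖g t - c‖) t := by
    intro t
    by_cases ht : t ∈ closedBall w b.rOut
    · rw [indicator_of_mem ht, norm_mul, Real.norm_of_nonneg (b.nonneg_normed _)]
      gcongr
      refine (b.normed_le_div_measure_closedBall_rOut volume 2 hb _).trans_eq ?_
      rw [measureReal_def, measureReal_def, Measure.addHaar_closedBall_center volume w]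
    · have : b.normed volume (w - t) = 0 := by
        by_contra hne
        exact ht (tsupport_normed_sub_left b w (subset_closure hne))
      simp [this, indicator_of_notMem ht]
  rw [h2, ← Real.norm_eq_abs]
  refine (norm_integral_le_of_norm_le
    (IntegrableOn.integrable_indicator (hgi.const_mul _) measurableSet_closedBall)
    (Eventually.of_forall h3)).trans_eq ?_
  rw [integral_indicator measurableSet_closedBall, integral_const_mul, setAverage_eq, smul_eq_mul]
  ring

/-- Lebesgue differentiation along balls that are not centred at `x`: the centre `(1 - s) x` is at
distance at most `s D`, which is `D / ρ` times the radius `s ρ`. -/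
lemma ae_tendsto_dilMollify (hCb : Bornology.IsBounded C)
    {ρ : ℝ} (hρ0 : 0 < ρ) (hg : Integrable g) :
    ∀ᵐ x, x ∈ C →
      Tendsto (fun n ↦ dilMollify (dilBump E hρ0 n) (dilStep n) g x) atTop (𝓝 (g x)) := by
  obtain ⟨D, hD⟩ := hCb.subset_closedBall 0
  have := IsUnifLocDoublingMeasure.ae_tendsto_average_norm_sub volume hg.locallyIntegrable (D / ρ)
  filter_upwards [this] with x hx hxC
  have hδ : Tendsto (fun n ↦ dilStep n * ρ) atTop (𝓝[>] 0) := by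
    refine tendsto_nhdsWithin_iff.2 ⟨?_, Eventually.of_forall fun n ↦ mul_pos (dilStep_pos n) hρ0⟩
    simpa using tendsto_dilStep.mul_const ρ
  have h1 := hx (fun n ↦ (1 - dilStep n) • x) (fun n ↦ dilStep n * ρ) hδ
    (Eventually.of_forall fun n ↦ by
      rw [mem_closedBall, dist_eq_norm]
      have : x - (1 - dilStep n) • x = dilStep n • x := by module
      rw [this, norm_smul, Real.norm_of_nonneg (dilStep_pos n).le]
      have h2 : ‖x‖ ≤ D := by simpa using hD hxC
      calc dilStep n * ‖x‖ ≤ dilStep n * D := by gcongr; exact (dilStep_pos n).le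
        _ = _ := by field_simp)
  rw [tendsto_iff_norm_sub_tendsto_zero]
  refine squeeze_zero (fun _ ↦ norm_nonneg _) (fun n ↦ ?_)
    (by simpa using h1.const_mul (2 ^ Module.finrank ℝ E))
  exact abs_mollify_sub_le (dilBump E hρ0 n) (by simp only [dilBump]; linarith) hg _ _

end Dilation

/-! ### `L¹` error of the smoothing, uniform in the function. -/

section Approximation

variable {E : Type*} [NormedAddCommGroup E] [InnerProductSpace ℝ E] [FiniteDimensional ℝ E]
  [MeasurableSpace E] [BorelSpace E]
  {C : Set E} {g : E → ℝ} {L : E → (E → ℝ) → ℝ} {κ : Measure E}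

/-- The smooth estimate applied to the approximants `u n`, whose gradients have uniformly bounded
mass, passes to `g` by Fatou. The step sizes of the approximants are unrelated to `s`. -/
lemma HasWeakGrad.setLIntegral_sub_homothety_le [IsFiniteMeasure κ] (h : HasWeakGrad C g L κ)
    (hCo : IsOpen C) (hCc : Convex ℝ C) (hCb : Bornology.IsBounded C)
    {ρ : ℝ} (hρ0 : 0 < ρ) (hρ : closedBall 0 ρ ⊆ C)
    {D : ℝ} (hD : ∀ x ∈ C, ∀ y ∈ C, ‖y - x‖ ≤ D) {s : ℝ} (hs0 : 0 ≤ s)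
    (hs : s ≤ 1 / 2) {y : E} (hy : y ∈ C) :
    ∫⁻ x in C, ‖g ((1 - s) • x + s • y) - g x‖ₑ ≤
      ENNReal.ofReal (s * D) * 2 ^ Module.finrank ℝ E *
        (2 ^ Module.finrank ℝ E * κ univ) := by
  set u : ℕ → E → ℝ := fun n ↦ dilMollify (dilBump E hρ0 n) (dilStep n) g with hu
  have hus : ∀ n, ContDiff ℝ ∞ (u n) := fun n ↦ contDiff_dilMollify _ _ h.integrable
  have hlim := ae_tendsto_dilMollify hCb hρ0 h.integrable
  have hlim' := (quasiMeasurePreserving_smul_add (by linarith : 1 - s ≠ 0) (s • y)).ae hlim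
  have hae : ∀ᵐ x ∂volume.restrict C, ‖g ((1 - s) • x + s • y) - g x‖ₑ =
      liminf (fun n ↦ ‖u n ((1 - s) • x + s • y) - u n x‖ₑ) atTop := by
    rw [ae_restrict_iff' hCo.measurableSet]
    filter_upwards [hlim, hlim'] with x h1 h2 hx
    have h3 : (1 - s) • x + s • y ∈ C := hCc hx hy (by linarith) hs0 (by ring)
    exact (((h2 h3).sub (h1 hx)).enorm.liminf_eq).symm
  rw [lintegral_congr_ae hae]
  refine (lintegral_liminf_le fun n ↦ ?_).trans ?_
  · have := (hus n).continuous
    exact Continuous.measurable (by fun_prop)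
  refine liminf_le_of_frequently_le' (Eventually.frequently (Eventually.of_forall fun n ↦ ?_))
  refine (_root_.setLIntegral_sub_homothety_le hCo hCc ((hus n).of_le (by simp)) hD hs0 hs
    hy).trans ?_
  gcongr
  exact h.setLIntegral_fderiv_dilMollify_le hCo hCc hρ _ (dilStep_pos n) (dilStep_le n) le_rfl

lemma HasWeakGrad.setLIntegral_dilMollify_sub_le [IsFiniteMeasure κ] (h : HasWeakGrad C g L κ)
    (hCo : IsOpen C) (hCc : Convex ℝ C) (hCb : Bornology.IsBounded C)
    {ρ : ℝ} (hρ0 : 0 < ρ) (hρ : closedBall 0 ρ ⊆ C)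
    {D : ℝ} (hD : ∀ x ∈ C, ∀ y ∈ C, ‖y - x‖ ≤ D) (b : ContDiffBump (0 : E)) {s : ℝ} (hs0 : 0 < s)
    (hs : s ≤ 1 / 2) (hb : b.rOut ≤ s * ρ) :
    ∫⁻ x in C, ‖dilMollify b s g x - g x‖ₑ ≤
      ENNReal.ofReal (s * D) * 2 ^ Module.finrank ℝ E *
        (2 ^ Module.finrank ℝ E * κ univ) := by
  have hkc : Continuous (b.normed volume) := b.continuous_normed
  have hgm : Measurable g := h.stronglyMeasurable.measurable
  have key : ∀ x, ‖dilMollify b s g x - g x‖ₑ ≤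
      ∫⁻ t, ENNReal.ofReal (b.normed volume t) * ‖g ((1 - s) • x - t) - g x‖ₑ := by
    intro x
    have hi1 : Integrable (fun t ↦ b.normed volume t * g ((1 - s) • x - t)) :=
      (b.hasCompactSupport_normed (μ := volume)).convolutionExists_left
        (lsmul ℝ ℝ) hkc h.integrable.locallyIntegrable _
    have hi2 : Integrable (fun t ↦ b.normed volume t * g x) := b.integrable_normed.mul_const _
    have h2 : dilMollify b s g x - g x =
        ∫ t, b.normed volume t * (g ((1 - s) • x - t) - g x) := by
      simp only [mul_sub]
      rw [integral_sub hi1 hi2, integral_mul_const, b.integral_normed, one_mul]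
      rfl
    rw [h2]
    refine (enorm_integral_le_lintegral_enorm _).trans_eq ?_
    congr 1 with t
    rw [enorm_mul, Real.enorm_of_nonneg (b.nonneg_normed _)]
  calc ∫⁻ x in C, ‖dilMollify b s g x - g x‖ₑ
      ≤ ∫⁻ x in C, ∫⁻ t, ENNReal.ofReal (b.normed volume t) * ‖g ((1 - s) • x - t) - g x‖ₑ :=
        lintegral_mono key
    _ = ∫⁻ t, ∫⁻ x in C, ENNReal.ofReal (b.normed volume t) * ‖g ((1 - s) • x - t) - g x‖ₑ := by
        refine lintegral_lintegral_swap (Measurable.aemeasurable ?_)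
        have := hkc.measurable
        exact (by fun_prop : Measurable fun p : E × E ↦ ENNReal.ofReal (b.normed volume p.2) *
          ‖g ((1 - s) • p.1 - p.2) - g p.1‖ₑ)
    _ ≤ ∫⁻ t, ENNReal.ofReal (b.normed volume t) *
        (ENNReal.ofReal (s * D) * 2 ^ Module.finrank ℝ E *
        (2 ^ Module.finrank ℝ E * κ univ)) := by
        refine lintegral_mono fun t ↦ ?_
        by_cases ht : b.normed volume t = 0
        · simp [ht]
        have hts : t ∈ Function.support (b.normed volume) := ht
        rw [b.support_normed_eq, mem_ball, dist_zero_right] at hts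
        -- A shift by `-t` within the kernel's support is a homothety towards a point of `C`: `(1 -
        -- s) x - t = (1 - s) x + s y` with `y = -t / s`.
        have hy : -(s⁻¹ • t) ∈ C := by
          refine hρ ?_
          rw [mem_closedBall, dist_zero_right, norm_neg, norm_smul, norm_inv,
            Real.norm_of_nonneg hs0.le, inv_mul_le_iff₀ hs0]
          exact hts.le.trans hb
        have h1 := h.setLIntegral_sub_homothety_le hCo hCc hCb hρ0 hρ hD hs0.le hs hy
        simp only [smul_neg, smul_smul, mul_inv_cancel₀ hs0.ne', one_smul, ← sub_eq_add_neg]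
          at h1
        rw [lintegral_const_mul _ (by fun_prop)]
        gcongr
    _ = _ := by
        rw [lintegral_mul_const _ hkc.measurable.ennreal_ofReal, lintegral_ofReal_normed, one_mul]

end Approximation

/-! ### Compactness in `L¹` modulo constants. -/

section Compactness

variable {E : Type*} [NormedAddCommGroup E] [InnerProductSpace ℝ E] [FiniteDimensional ℝ E]
  [MeasurableSpace E] [BorelSpace E]
  {C : Set E} {g : ℕ → E → ℝ} {L : ℕ → E → (E → ℝ) → ℝ} {κ : ℕ → Measure E}
  {T : E → (E → ℝ) → ℝ}

lemma abs_fderiv_dilMollify_apply_le {g : E → ℝ} {L : E → (E → ℝ) → ℝ} {κ : Measure E}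
    [IsFiniteMeasure κ] (h : HasWeakGrad C g L κ) (hκ : κ univ ≤ 1) (b : ContDiffBump (0 : E))
    {s : ℝ} (hs0 : 0 ≤ s) (hs1 : s ≤ 1) {M : ℝ} (hM : ∀ z, b.normed volume z ≤ M)
    {x : E} (hx : closedBall ((1 - s) • x) b.rOut ⊆ C) (e : E) :
    ‖fderiv ℝ (dilMollify b s g) x e‖ ≤ M * ‖e‖ := by
  have hM0 : 0 ≤ M := (b.nonneg_normed 0).trans (hM 0)
  refine (ContinuousLinearMap.le_opNorm _ _).trans ?_
  gcongr
  have h1 := h.enorm_fderiv_dilMollify_le b hs0 hs1 hx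
  rw [← ofReal_norm] at h1
  rw [← ENNReal.ofReal_le_ofReal_iff hM0]
  calc _ ≤ _ := h1
    _ ≤ ∫⁻ t, ENNReal.ofReal M ∂κ := by gcongr; exact hM _
    _ = ENNReal.ofReal M * κ univ := lintegral_const _
    _ ≤ _ := mul_le_of_le_one_right' hκ

lemma exists_forall_normed_le (b : ContDiffBump (0 : E)) : ∃ M, ∀ z, b.normed volume z ≤ M := by
  obtain ⟨M, hM⟩ := b.hasCompactSupport_normed (μ := (volume : Measure E)) |>.exists_bound_of_continuous
    b.continuous_normed
  exact ⟨M, fun z ↦ (le_abs_self _).trans (hM z)⟩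

/-- If the weak gradients of the `g n` converge, the mollifications of the `g n` converge pointwise
and boundedly, up to additive constants. -/
lemma exists_tendsto_dilMollify_sub [∀ n, IsFiniteMeasure (κ n)]
    (h : ∀ n, HasWeakGrad C (g n) (L n) (κ n)) (hκ : ∀ n, κ n univ ≤ 1)
    (hT : ∀ φ : E → ℝ, ContDiff ℝ ∞ φ → HasCompactSupport φ → tsupport φ ⊆ C →
      ∀ e, Tendsto (fun n ↦ L n e φ) atTop (𝓝 (T e φ)))
    (hCc : Convex ℝ C) {ρ : ℝ} (hρ0 : 0 < ρ) (hρ : closedBall 0 ρ ⊆ C)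
    (b : ContDiffBump (0 : E)) {s : ℝ} (hs0 : 0 < s) (hs : s ≤ 1 / 2) (hb : b.rOut ≤ s * ρ)
    {M : ℝ} (hM : ∀ z, b.normed volume z ≤ M) {x : E} (hx : x ∈ C) :
    (∃ l, Tendsto (fun n ↦ dilMollify b s (g n) x - dilMollify b s (g n) 0) atTop (𝓝 l)) ∧
    ∀ n, ‖dilMollify b s (g n) x - dilMollify b s (g n) 0‖ ≤ M * ‖x‖ := by
  have h0C : (0 : E) ∈ C := hρ (mem_closedBall_self hρ0.le)
  have hsmooth : ∀ n, ContDiff ℝ 1 (dilMollify b s (g n)) := fun n ↦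
    (contDiff_dilMollify b s (h n).integrable).of_le (by simp)
  have htx : ∀ t ∈ uIcc (0 : ℝ) 1, closedBall ((1 - s) • (t • x)) b.rOut ⊆ C := by
    intro t ht
    rw [uIcc_of_le zero_le_one] at ht
    refine hCc.closedBall_smul_subset hρ hs0 (by linarith) hb ?_
    have := hCc h0C hx (by linarith [ht.2] : 0 ≤ 1 - t) ht.1 (by ring)
    simpa using this
  have hftc : ∀ n, dilMollify b s (g n) x - dilMollify b s (g n) 0 =
      ∫ t in (0 : ℝ)..1, fderiv ℝ (dilMollify b s (g n)) (t • x) x := by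
    intro n
    have hd : ∀ t : ℝ, HasDerivAt (fun t : ℝ ↦ dilMollify b s (g n) (t • x))
        (fderiv ℝ (dilMollify b s (g n)) (t • x) x) t := by
      intro t
      have h1 : HasDerivAt (fun t : ℝ ↦ t • x) x t := by
        simpa using (hasDerivAt_id t).smul_const x
      exact ((hsmooth n).differentiable one_ne_zero _).hasFDerivAt.comp_hasDerivAt t h1
    have hc : Continuous fun t : ℝ ↦ fderiv ℝ (dilMollify b s (g n)) (t • x) x :=
      (((hsmooth n).continuous_fderiv one_ne_zero).comp (by fun_prop)).clm_apply continuous_const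
    rw [intervalIntegral.integral_eq_sub_of_hasDerivAt (fun t _ ↦ hd t)
      (hc.intervalIntegrable 0 1)]
    simp
  have hbd : ∀ n, ∀ t ∈ uIcc (0 : ℝ) 1,
      ‖fderiv ℝ (dilMollify b s (g n)) (t • x) x‖ ≤ M * ‖x‖ := fun n t ht ↦
    abs_fderiv_dilMollify_apply_le (h n) (hκ n) b hs0.le (by linarith) hM (htx t ht) x
  constructor
  · simp only [hftc]
    -- For fixed `t` the integrand is the weak gradient tested against one fixed kernel, so it
    -- converges by `hT`; `M * ‖x‖` dominates it.
    refine ⟨∫ t in (0 : ℝ)..1, (1 - s) *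
      T x (fun z ↦ b.normed volume ((1 - s) • (t • x) - z)), ?_⟩
    refine intervalIntegral.tendsto_integral_filter_of_dominated_convergence (fun _ ↦ M * ‖x‖)
      (Eventually.of_forall fun n ↦ ?_)
      (Eventually.of_forall fun n ↦ Eventually.of_forall fun t ht ↦ ?_)
      intervalIntegrable_const (Eventually.of_forall fun t ht ↦ ?_)
    · exact ((((hsmooth n).continuous_fderiv one_ne_zero).comp (by fun_prop)).clm_apply
        continuous_const).aestronglyMeasurable
    · exact hbd n t (uIoc_subset_uIcc ht)
    · have ht' := htx t (uIoc_subset_uIcc ht)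
      simp only [fun n ↦ (h n).fderiv_dilMollify b s ht' x]
      exact (hT _ (contDiff_normed_sub_left b _) (hasCompactSupport_normed_sub_left b _)
        ((tsupport_normed_sub_left b _).trans ht') x).const_mul _
  · intro n
    rw [hftc]
    refine (intervalIntegral.norm_integral_le_of_norm_le_const (C := M * ‖x‖) fun t ht ↦
      hbd n t (uIoc_subset_uIcc ht)).trans_eq ?_
    simp

/-- The smoothing error is small uniformly in `n`, so one scale serves the whole sequence. At that
scale the smoothed functions, normalized at 0, converge in `L¹(C)` by dominated convergence. -/
lemma exists_setLIntegral_sub_sub_le [∀ n, IsFiniteMeasure (κ n)]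
    (h : ∀ n, HasWeakGrad C (g n) (L n) (κ n)) (hκ : ∀ n, κ n univ ≤ 1)
    (hT : ∀ φ : E → ℝ, ContDiff ℝ ∞ φ → HasCompactSupport φ → tsupport φ ⊆ C →
      ∀ e, Tendsto (fun n ↦ L n e φ) atTop (𝓝 (T e φ)))
    (hCo : IsOpen C) (hCc : Convex ℝ C) (hCb : Bornology.IsBounded C) (h0C : (0 : E) ∈ C)
    {δ : ℝ≥0∞} (hδ : 0 < δ) :
    ∃ N, ∀ n ≥ N, ∀ m ≥ N, ∃ c : ℝ, ∫⁻ x in C, ‖g n x - g m x - c‖ₑ ≤ δ := by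
  obtain ⟨ρ, hρ0, hρ⟩ : ∃ ρ, 0 < ρ ∧ closedBall (0 : E) ρ ⊆ C :=
    nhds_basis_closedBall.mem_iff.1 (hCo.mem_nhds h0C)
  obtain ⟨R, hR⟩ := hCb.subset_closedBall (0 : E)
  have hR' : ∀ x ∈ C, ‖x‖ ≤ R := fun x hx ↦ by simpa using hR hx
  have hD : ∀ x ∈ C, ∀ y ∈ C, ‖y - x‖ ≤ R + R := fun x hx y hy ↦
    (norm_sub_le _ _).trans (add_le_add (hR' y hy) (hR' x hx))
  have hvol : volume C < ⊤ := hCb.measure_lt_top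
  have hfin : IsFiniteMeasure (volume.restrict C) := ⟨by simpa using hvol⟩
  set A : ℝ≥0∞ := 2 ^ Module.finrank ℝ E with hA
  have hAtop : A ≠ ⊤ := by simp [hA]
  have hδ4 : 0 < δ / 4 := ENNReal.div_pos hδ.ne' (by simp)
  have hsmall : Tendsto (fun i ↦ ENNReal.ofReal (dilStep i * (R + R)) * A * (A * 1)) atTop
      (𝓝 0) := by
    have h1 : Tendsto (fun i ↦ ENNReal.ofReal (dilStep i * (R + R))) atTop (𝓝 0) := by
      simpa using ENNReal.tendsto_ofReal (tendsto_dilStep.mul_const (R + R))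
    have h2 := ENNReal.Tendsto.mul_const (b := A * (A * 1)) h1
      (Or.inr (ENNReal.mul_ne_top hAtop (by simpa using hAtop)))
    simpa [mul_assoc] using h2
  -- The scale is fixed before `N`: two smoothing errors and two distances to the limit `l` each get
  -- a quarter of `δ`.
  obtain ⟨i, hi⟩ := (hsmall.eventually (ge_mem_nhds hδ4)).exists
  set b := dilBump E hρ0 i
  set s := dilStep i
  obtain ⟨M, hM⟩ := exists_forall_normed_le b
  have hM0 : 0 ≤ M := (b.nonneg_normed 0).trans (hM 0)
  set F : ℕ → E → ℝ := fun n x ↦ dilMollify b s (g n) x - dilMollify b s (g n) 0 with hF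
  have hFm : ∀ n, Continuous (F n) := fun n ↦
    (contDiff_dilMollify b s (h n).integrable).continuous.sub continuous_const
  have hFx : ∀ x ∈ C, (∃ l, Tendsto (fun n ↦ F n x) atTop (𝓝 l)) ∧ ∀ n, ‖F n x‖ ≤ M * ‖x‖ :=
    fun x hx ↦ exists_tendsto_dilMollify_sub h hκ hT hCc hρ0 hρ b (dilStep_pos i) (dilStep_le i)
      le_rfl hM hx
  choose! l hl using fun x hx ↦ (hFx x hx).1
  have hL1 := tendsto_lintegral_norm_of_dominated_convergence (μ := volume.restrict C)
    (F := F) (f := l) (bound := fun _ ↦ M * R) (fun n ↦ (hFm n).aestronglyMeasurable)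
    (hasFiniteIntegral_const _)
    (fun n ↦ (ae_restrict_iff' hCo.measurableSet).2 (Eventually.of_forall fun x hx ↦
      ((hFx x hx).2 n).trans (by gcongr; exact hR' x hx)))
    ((ae_restrict_iff' hCo.measurableSet).2 (Eventually.of_forall fun x hx ↦ hl x hx))
  simp only [ofReal_norm] at hL1
  obtain ⟨N, hN⟩ := eventually_atTop.1 (hL1.eventually (ge_mem_nhds hδ4))
  have hmoll : ∀ n, ∫⁻ x in C, ‖dilMollify b s (g n) x - g n x‖ₑ ≤ δ / 4 := by
    intro n
    refine ((h n).setLIntegral_dilMollify_sub_le hCo hCc hCb hρ0 hρ hD b (dilStep_pos i)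
      (dilStep_le i) le_rfl).trans (le_trans ?_ hi)
    gcongr
    exact hκ n
  have hlm : AEMeasurable l (volume.restrict C) :=
    aemeasurable_of_tendsto_metrizable_ae atTop (fun n ↦ (hFm n).aemeasurable)
      ((ae_restrict_iff' hCo.measurableSet).2 (Eventually.of_forall fun x hx ↦ hl x hx))
  refine ⟨N, fun n hn m hm ↦ ⟨dilMollify b s (g n) 0 - dilMollify b s (g m) 0, ?_⟩⟩
  have hgm : ∀ n, Measurable (g n) := fun n ↦ (h n).stronglyMeasurable.measurable
  have hdm : ∀ n, Measurable (dilMollify b s (g n)) := fun n ↦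
    (contDiff_dilMollify b s (h n).integrable).continuous.measurable
  calc ∫⁻ x in C, ‖g n x - g m x - (dilMollify b s (g n) 0 - dilMollify b s (g m) 0)‖ₑ
      ≤ ∫⁻ x in C, (‖dilMollify b s (g n) x - g n x‖ₑ + ‖dilMollify b s (g m) x - g m x‖ₑ +
          (‖F n x - l x‖ₑ + ‖F m x - l x‖ₑ)) := by
        refine lintegral_mono fun x ↦ ?_
        have : g n x - g m x - (dilMollify b s (g n) 0 - dilMollify b s (g m) 0) =
          -(dilMollify b s (g n) x - g n x) + (dilMollify b s (g m) x - g m x) +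
          ((F n x - l x) + -(F m x - l x)) := by simp only [hF]; ring
        rw [this]
        refine (enorm_add_le _ _).trans (add_le_add ((enorm_add_le _ _).trans ?_)
          ((enorm_add_le _ _).trans ?_)) <;> simp only [enorm_neg, le_refl]
    _ = (∫⁻ x in C, ‖dilMollify b s (g n) x - g n x‖ₑ) +
        (∫⁻ x in C, ‖dilMollify b s (g m) x - g m x‖ₑ) +
        ((∫⁻ x in C, ‖F n x - l x‖ₑ) + ∫⁻ x in C, ‖F m x - l x‖ₑ) := by
        rw [lintegral_add_left, lintegral_add_left, lintegral_add_left']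
        · exact ((hFm n).aemeasurable.sub hlm).enorm
        · exact ((hdm n).sub (hgm n)).enorm
        · exact ((hdm n).sub (hgm n)).enorm.add ((hdm m).sub (hgm m)).enorm
    _ ≤ δ / 4 + δ / 4 + (δ / 4 + δ / 4) :=
        add_le_add (add_le_add (hmoll n) (hmoll m)) (add_le_add (hN n hn) (hN m hm))
    _ = δ := by
        rw [ENNReal.div_eq_inv_mul, ← two_mul, ← two_mul, ← mul_assoc, ← mul_assoc]
        have : (2 : ℝ≥0∞) * 2 = 4 := by norm_num
        rw [this, ENNReal.mul_inv_cancel (by simp) (by simp), one_mul]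

omit [NormedAddCommGroup E] [InnerProductSpace ℝ E] [FiniteDimensional ℝ E] [BorelSpace E] in
-- Turns smallness up to an unknown constant into smallness after subtracting the mean, at the cost
-- of a factor 2. This replaces the unspecified constants `c` by a consistent normalization.
lemma setLIntegral_enorm_sub_average_le {μ : Measure E} [IsFiniteMeasure μ] {f : E → ℝ}
    (hf : Integrable f μ) : ∫⁻ x, ‖f x - ⨍ y, f y ∂μ‖ₑ ∂μ ≤ 2 * ∫⁻ x, ‖f x‖ₑ ∂μ := by
  rcases eq_or_ne μ 0 with rfl | hμ
  · simp
  have h0 : μ univ ≠ 0 := by simpa using hμ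
  calc ∫⁻ x, ‖f x - ⨍ y, f y ∂μ‖ₑ ∂μ ≤ ∫⁻ x, (‖f x‖ₑ + ‖⨍ y, f y ∂μ‖ₑ) ∂μ :=
        lintegral_mono fun x ↦ enorm_sub_le
    _ = ∫⁻ x, ‖f x‖ₑ ∂μ + ‖⨍ y, f y ∂μ‖ₑ * μ univ := by
        rw [lintegral_add_right _ measurable_const, lintegral_const]
    _ ≤ ∫⁻ x, ‖f x‖ₑ ∂μ + ∫⁻ x, ‖f x‖ₑ ∂μ := by
        gcongr
        rw [average_eq, enorm_smul, mul_comm, ← mul_assoc]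
        have : μ univ * ‖(μ.real univ)⁻¹‖ₑ = 1 := by
          rw [Real.enorm_of_nonneg (by positivity), measureReal_def, ENNReal.ofReal_inv_of_pos
            (ENNReal.toReal_pos h0 (measure_ne_top _ _)),
            ENNReal.ofReal_toReal (measure_ne_top _ _),
            ENNReal.mul_inv_cancel h0 (measure_ne_top _ _)]
        rw [this, one_mul]
        exact enorm_integral_le_lintegral_enorm _
    _ = _ := (two_mul _).symm

lemma integral_fderiv_eq_zero {φ : E → ℝ} (hφ : ContDiff ℝ 1 φ) (hc : HasCompactSupport φ)
    (e : E) : ∫ x, fderiv ℝ φ x e = 0 := by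
  have hd : Integrable fun x ↦ fderiv ℝ φ x e :=
    ((hφ.continuous_fderiv one_ne_zero).clm_apply continuous_const).integrable_of_hasCompactSupport
      (hc.fderiv_apply ℝ e)
  have hφi : Integrable φ := hφ.continuous.integrable_of_hasCompactSupport hc
  have := integral_mul_fderiv_eq_neg_fderiv_mul_of_integrable (μ := (volume : Measure E))
    (f := fun _ ↦ (1 : ℝ)) (g := φ)
    (v := e) (by simp) (by simpa using hd) (by simpa using hφi)
    (fun _ _ ↦ differentiableAt_const _)
    (fun x _ ↦ hφ.differentiable one_ne_zero x)
  simpa using this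

/-- A limit of weak gradients with bounded mass on a bounded convex set is a weak gradient. -/
theorem exists_integral_mul_fderiv_eq_of_tendsto [∀ n, IsFiniteMeasure (κ n)]
    (h : ∀ n, HasWeakGrad C (g n) (L n) (κ n)) (hκ : ∀ n, κ n univ ≤ 1)
    (hT : ∀ φ : E → ℝ, ContDiff ℝ ∞ φ → HasCompactSupport φ → tsupport φ ⊆ C →
      ∀ e, Tendsto (fun n ↦ L n e φ) atTop (𝓝 (T e φ)))
    (hCo : IsOpen C) (hCc : Convex ℝ C) (hCb : Bornology.IsBounded C) (h0C : (0 : E) ∈ C) :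
    ∃ v : E → ℝ, IntegrableOn v C ∧ ∀ φ : E → ℝ, ContDiff ℝ ∞ φ → HasCompactSupport φ →
      tsupport φ ⊆ C → ∀ e, ∫ x in C, v x * fderiv ℝ φ x e = -T e φ := by
  have hvol : volume C < ⊤ := hCb.measure_lt_top
  have hfin : IsFiniteMeasure (volume.restrict C) := ⟨by simpa using hvol⟩
  set μ := volume.restrict C with hμ
  have hgi : ∀ n, Integrable (g n) μ := fun n ↦ (h n).integrable.integrableOn
  set w : ℕ → E → ℝ := fun n x ↦ g n x - ⨍ y, g n y ∂μ with hw
  have hwi : ∀ n, Integrable (w n) μ := fun n ↦ (hgi n).sub (integrable_const _)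
  have hcau : CauchySeq fun n ↦ (hwi n).toL1 (w n) := by
    rw [EMetric.cauchySeq_iff]
    intro ε hε
    obtain ⟨δ, hδ0, hδ⟩ : ∃ δ, 0 < δ ∧ 2 * δ < ε := by
      obtain ⟨η, hη0, hη⟩ := exists_between hε
      exact ⟨η / 2, ENNReal.half_pos hη0.ne', by rwa [ENNReal.mul_div_cancel (by simp) (by simp)]⟩
    obtain ⟨N, hN⟩ := exists_setLIntegral_sub_sub_le h hκ hT hCo hCc hCb h0C hδ0
    refine ⟨N, fun n hn m hm ↦ ?_⟩
    obtain ⟨c, hc⟩ := hN n hn m hm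
    have hci : Integrable (fun x ↦ g n x - g m x - c) μ :=
      ((hgi n).sub (hgi m)).sub (integrable_const _)
    rw [Integrable.edist_toL1_toL1]
    refine lt_of_le_of_lt ?_ (lt_of_le_of_lt ((setLIntegral_enorm_sub_average_le hci).trans
      (mul_le_mul_right hc 2)) hδ)
    rcases eq_or_ne μ 0 with h0 | h0
    · simp [h0]
    refine lintegral_mono fun x ↦ le_of_eq ?_
    -- The constant `c` cancels on subtracting the mean, so the centred form of `g n - g m - c` is
    -- exactly `w n - w m`.
    have havg : ⨍ y, (g n y - g m y - c) ∂μ = ⨍ y, g n y ∂μ - ⨍ y, g m y ∂μ - c := by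
      have : NeZero μ := ⟨h0⟩
      have h1 : ∫ y, (g n y - g m y - c) ∂μ = ∫ y, g n y ∂μ - ∫ y, g m y ∂μ - ∫ _, c ∂μ := by
        rw [← integral_sub (hgi n) (hgi m)]
        exact integral_sub ((hgi n).sub (hgi m)) (integrable_const _)
      rw [average_eq, h1, smul_sub, smul_sub, ← average_eq, ← average_eq, ← average_eq,
        average_const]
    rw [edist_eq_enorm_sub, havg]
    congr 1
    simp only [hw]; ring
  obtain ⟨v, hv⟩ := cauchySeq_tendsto_of_complete hcau
  have hvi : Integrable v μ := L1.integrable_coeFn v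
  have hv' : Tendsto (fun n ↦ ∫⁻ x, ‖w n x - v x‖ₑ ∂μ) atTop (𝓝 0) := by
    rw [tendsto_iff_edist_tendsto_0] at hv
    refine hv.congr fun n ↦ ?_
    have : v = hvi.toL1 v := (Integrable.toL1_coeFn v hvi).symm
    conv_lhs => rw [this]
    rw [Integrable.edist_toL1_toL1]
    simp only [edist_eq_enorm_sub]
  refine ⟨v, hvi, fun φ hφ hφc hφC e ↦ ?_⟩
  have hφ1 : ContDiff ℝ 1 φ := hφ.of_le (by simp)
  have hdc : Continuous fun x ↦ fderiv ℝ φ x e :=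
    (hφ1.continuous_fderiv one_ne_zero).clm_apply continuous_const
  obtain ⟨M, hM⟩ := (hφc.fderiv_apply ℝ e).exists_bound_of_continuous hdc
  have hlim1 : Tendsto (fun n ↦ ∫ x, w n x * fderiv ℝ φ x e ∂μ) atTop
      (𝓝 (∫ x, v x * fderiv ℝ φ x e ∂μ)) := by
    refine tendsto_integral_of_L1 _ (hvi.aestronglyMeasurable.mul hdc.aestronglyMeasurable)
      (Eventually.of_forall fun n ↦ (hwi n).mul_bdd hdc.aestronglyMeasurable
        (Eventually.of_forall hM)) ?_
    have hv2 := ENNReal.Tendsto.mul_const hv' (Or.inr (ENNReal.ofReal_ne_top (r := M)))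
    rw [zero_mul] at hv2
    refine tendsto_of_tendsto_of_tendsto_of_le_of_le tendsto_const_nhds hv2
      (fun _ ↦ zero_le) fun n ↦ ?_
    dsimp only [Pi.mul_apply]
    rw [← lintegral_mul_const' _ _ ENNReal.ofReal_ne_top]
    refine lintegral_mono fun x ↦ ?_
    rw [← sub_mul, enorm_mul]
    gcongr
    rw [← ofReal_norm]
    exact ENNReal.ofReal_le_ofReal (hM x)
  have hsupp : ∀ f : E → ℝ, ∫ x, f x * fderiv ℝ φ x e ∂μ = ∫ x, f x * fderiv ℝ φ x e := by
    intro f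
    refine setIntegral_eq_integral_of_forall_compl_eq_zero fun x hx ↦ ?_
    have : fderiv ℝ φ x = 0 := by
      by_contra hne
      exact hx (hφC (support_fderiv_subset ℝ hne))
    simp [this]
  -- Subtracting the mean does not change the weak derivative, since derivatives of test functions
  -- have integral zero.
  have hlim2 : ∀ n, ∫ x, w n x * fderiv ℝ φ x e ∂μ = -L n e φ := by
    intro n
    have hdi : Integrable fun x ↦ fderiv ℝ φ x e :=
      hdc.integrable_of_hasCompactSupport (hφc.fderiv_apply ℝ e)
    rw [hsupp, ← (h n).integral_eq φ hφ hφc hφC e]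
    simp only [hw, sub_mul]
    rw [integral_sub ((h n).integrable.mul_bdd hdc.aestronglyMeasurable (Eventually.of_forall hM))
      (hdi.const_mul _), integral_const_mul, integral_fderiv_eq_zero hφ1 hφc, mul_zero, sub_zero]
  simp only [hlim2] at hlim1
  exact tendsto_nhds_unique hlim1 (hT φ hφ hφc hφC e).neg

end Compactness

/-! ### Matrix-valued measures and their blow-ups. -/

section VectorMeasures

/-- Each component is a signed measure, hence of finite variation, and the variation of `μ` is at
most the sum of theirs. -/
lemma isFiniteMeasure_variation_euclideanSpace {X ι : Type*} [MeasurableSpace X] [Fintype ι]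
    (μ : VectorMeasure X (EuclideanSpace ℝ ι)) : IsFiniteMeasure μ.variation := by
  classical
  set ν : ι → SignedMeasure X := fun i ↦
    μ.mapRange (EuclideanSpace.proj (𝕜 := ℝ) i : EuclideanSpace ℝ ι →L[ℝ] ℝ).toLinearMap.toAddMonoidHom
      (EuclideanSpace.proj (𝕜 := ℝ) i : EuclideanSpace ℝ ι →L[ℝ] ℝ).continuous with hν
  have hfin : ∀ i, IsFiniteMeasure (ν i).variation := fun i ↦ by
    rw [← SignedMeasure.totalVariation_eq_variation]; infer_instance
  have hle : μ.variation ≤ ∑ i, (ν i).variation := by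
    refine VectorMeasure.variation_le_of_forall_enorm_le fun A hA ↦ ?_
    rw [Measure.finsetSum_apply]
    have h1 : μ A = ∑ i, EuclideanSpace.single i (μ A i) := by
      ext j; simp
    calc ‖μ A‖ₑ = ‖∑ i, EuclideanSpace.single i (μ A i)‖ₑ := by rw [← h1]
      _ ≤ ∑ i, ‖EuclideanSpace.single i (μ A i)‖ₑ := enorm_sum_le _ _
      _ ≤ ∑ i, (ν i).variation A := by
        refine Finset.sum_le_sum fun i _ ↦ ?_
        have h2 : ‖EuclideanSpace.single i (μ A i)‖ₑ = ‖ν i A‖ₑ := by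
          rw [← ofReal_norm, ← ofReal_norm, PiLp.norm_single]; rfl
        rw [h2]
        exact VectorMeasure.enorm_measure_le_variation _ _
  exact isFiniteMeasure_of_le _ hle

lemma norm_integral_smul_vectorMeasure_le {X V : Type*} [MeasurableSpace X] [NormedAddCommGroup V]
    [NormedSpace ℝ V] (γ : VectorMeasure X V) (φ : X → ℝ) :
    ‖∫ᵛ x, φ x ∂•γ‖ ≤ ∫ x, |φ x| ∂γ.variation := by
  refine (VectorMeasure.norm_integral_le_integral_norm).trans ?_
  refine (mul_le_mul_of_nonneg_right (ContinuousLinearMap.opNorm_lsmul_le (R := ℝ))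
    (integral_nonneg fun _ ↦ norm_nonneg _)).trans_eq ?_
  rw [one_mul]; rfl

/-- If a vector measure of mass at most one has total value almost `p` with `‖p‖ = 1`, then its
integrals of functions with values in `[0, 1]` almost point in the direction `p`. -/
lemma norm_integral_le_inner_add {X V : Type*} [MeasurableSpace X] [NormedAddCommGroup V]
    [InnerProductSpace ℝ V] [CompleteSpace V] (γ : VectorMeasure X V)
    [IsFiniteMeasure γ.variation] (hγ : γ.variation univ ≤ 1) {p : V} (hp : ‖p‖ = 1)
    {φ : X → ℝ} (hφm : Measurable φ) (hφ : ∀ x, φ x ∈ Icc (0 : ℝ) 1) :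
    ‖∫ᵛ x, φ x ∂•γ‖ ≤ inner ℝ p (∫ᵛ x, φ x ∂•γ) + (1 - inner ℝ p (γ univ)) := by
  have hi : Integrable φ γ.variation :=
    Integrable.of_bound hφm.aestronglyMeasurable 1 (Eventually.of_forall fun x ↦ by
      rw [Real.norm_of_nonneg (hφ x).1]; exact (hφ x).2)
  have h1 : ∫ᵛ x, (1 - φ x) ∂•γ = γ univ - ∫ᵛ x, φ x ∂•γ := by
    rw [VectorMeasure.integral_fun_sub (integrable_const _) hi, VectorMeasure.integral_const]
    simp
  have h2 := norm_integral_smul_vectorMeasure_le γ φ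
  have h3 := norm_integral_smul_vectorMeasure_le γ (fun x ↦ 1 - φ x)
  rw [h1] at h3
  -- The masses seen by `φ` and `1 - φ` share a budget of one. As `1 - φ` uses at least the
  -- `p`-component of its integral, `φ` is left with little more than its own `p`-component.
  have h4 : ∫ x, |φ x| ∂γ.variation + ∫ x, |1 - φ x| ∂γ.variation ≤ 1 := by
    simp only [fun x ↦ abs_of_nonneg (hφ x).1, fun x ↦ abs_of_nonneg (sub_nonneg.2 (hφ x).2)]
    rw [integral_sub (integrable_const _) hi]
    simp only [integral_const, smul_eq_mul, mul_one, add_sub_cancel]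
    exact ENNReal.toReal_le_of_le_ofReal zero_le_one (by simpa using hγ)
  have h5 : inner ℝ p (γ univ - ∫ᵛ x, φ x ∂•γ) ≤ ‖γ univ - ∫ᵛ x, φ x ∂•γ‖ := by
    simpa [hp] using real_inner_le_norm p (γ univ - ∫ᵛ x, φ x ∂•γ)
  rw [inner_sub_right] at h5
  linarith

variable {m d : ℕ} {C : Set (EuclideanSpace ℝ (Fin d))} {x₀ : EuclideanSpace ℝ (Fin d)} {r : ℝ}

lemma preimage_eq_scaledCopy (hr : 0 < r) :
    (fun x ↦ r⁻¹ • (x - x₀)) ⁻¹' C = scaledCopy C x₀ r := by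
  ext x
  simp only [scaledCopy, mem_preimage, mem_image]
  constructor
  · intro hx
    exact ⟨_, hx, by rw [smul_smul, mul_inv_cancel₀ hr.ne', one_smul, add_sub_cancel]⟩
  · rintro ⟨y, hy, rfl⟩
    rwa [add_sub_cancel_left, smul_smul, inv_mul_cancel₀ hr.ne', one_smul]

lemma variation_blowUp_le (μ : MatMeasure m d) (hC : MeasurableSet C) (hr : 0 < r) :
    (blowUp μ C x₀ r).variation univ ≤ 1 := by
  have := isFiniteMeasure_variation_euclideanSpace μ
  have hT : Measurable fun x : EuclideanSpace ℝ (Fin d) ↦ r⁻¹ • (x - x₀) := by fun_prop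
  rw [blowUp, VectorMeasure.variation_smul, VectorMeasure.variation_restrict hC]
  rw [Measure.smul_apply, Measure.restrict_apply MeasurableSet.univ, univ_inter]
  have h1 : (μ.map fun x ↦ r⁻¹ • (x - x₀)).variation C ≤ μ.variation (scaledCopy C x₀ r) := by
    refine (VectorMeasure.variation_map_le C).trans_eq ?_
    rw [Measure.map_apply hT hC, preimage_eq_scaledCopy hr]
  set A := μ.variation (scaledCopy C x₀ r) with hA
  have hAt : A ≠ ⊤ := measure_ne_top _ _
  refine (mul_le_mul_right h1 _).trans ?_
  rcases eq_or_ne A 0 with h0 | h0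
  · simp [h0]
  have : (‖(μ.variation.real (scaledCopy C x₀ r))⁻¹‖₊ : ℝ≥0∞) = A⁻¹ := by
    rw [← enorm_eq_nnnorm, Real.enorm_of_nonneg (by positivity), measureReal_def, ← hA,
      ENNReal.ofReal_inv_of_pos (ENNReal.toReal_pos h0 hAt), ENNReal.ofReal_toReal hAt]
  rw [this, ENNReal.inv_mul_cancel h0 hAt]

lemma blowUp_univ (μ : MatMeasure m d) (hC : MeasurableSet C) (hr : 0 < r) :
    blowUp μ C x₀ r univ =
      (μ.variation.real (scaledCopy C x₀ r))⁻¹ • μ (scaledCopy C x₀ r) := by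
  have hT : Measurable fun x : EuclideanSpace ℝ (Fin d) ↦ r⁻¹ • (x - x₀) := by fun_prop
  rw [blowUp, smul_apply, VectorMeasure.restrict_apply _ hC MeasurableSet.univ,
    univ_inter, VectorMeasure.map_apply _ hT hC, preimage_eq_scaledCopy hr]

lemma integral_blowUp (μ : MatMeasure m d) (hC : MeasurableSet C)
    {φ : EuclideanSpace ℝ (Fin d) → ℝ} (hφ : Continuous φ) (hφc : HasCompactSupport φ)
    (hφC : ∀ x, x ∉ C → φ x = 0) :
    ∫ᵛ x, φ x ∂•(blowUp μ C x₀ r) = (μ.variation.real (scaledCopy C x₀ r))⁻¹ •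
      ∫ᵛ x, φ (r⁻¹ • (x - x₀)) ∂•μ := by
  have := isFiniteMeasure_variation_euclideanSpace μ
  have hT : Measurable fun x : EuclideanSpace ℝ (Fin d) ↦ r⁻¹ • (x - x₀) := by fun_prop
  obtain ⟨M, hM⟩ := hφc.exists_bound_of_continuous hφ
  rw [blowUp, VectorMeasure.integral_smul_vectorMeasure,
    VectorMeasure.setIntegral_eq_integral_of_forall_compl_eq_zero hC hφC,
    VectorMeasure.integral_map hT hφ.aestronglyMeasurable]
  exact Integrable.of_bound (hφ.measurable.comp hT).aestronglyMeasurable M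
    (Eventually.of_forall fun x ↦ hM _)

/-- The derivative of a rescaled `BV` function is the rescaled derivative. -/
lemma HasBVDeriv.blowUp {Ω : Set (EuclideanSpace ℝ (Fin d))}
    {u : EuclideanSpace ℝ (Fin d) → EuclideanSpace ℝ (Fin m)} {Du : MatMeasure m d}
    (hu : HasBVDeriv Ω u Du) (hC : IsOpen C) (hr : 0 < r) (hCΩ : scaledCopy C x₀ r ⊆ Ω) :
    HasBVDeriv C (fun y ↦ ((Du.variation.real (scaledCopy C x₀ r))⁻¹ * (r ^ d * r⁻¹)) •
      u (x₀ + r • y)) (blowUp Du C x₀ r) := by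
  have hS : MeasurableSet (scaledCopy C x₀ r) := by
    rw [← preimage_eq_scaledCopy hr]
    exact (by fun_prop : Measurable fun x : EuclideanSpace ℝ (Fin d) ↦ r⁻¹ • (x - x₀))
      hC.measurableSet
  have hinv : ∀ y : EuclideanSpace ℝ (Fin d), r⁻¹ • (x₀ + r • y - x₀) = y := fun y ↦ by
    rw [add_sub_cancel_left, smul_smul, inv_mul_cancel₀ hr.ne', one_smul]
  refine ⟨?_, ?_, fun φ hφ hφc hφC i j ↦ ?_⟩
  · have h1 : Integrable ((scaledCopy C x₀ r).indicator u) :=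
      (hu.integrableOn.mono_set hCΩ).integrable_indicator hS
    have h2 : Integrable fun y ↦ (scaledCopy C x₀ r).indicator u (x₀ + r • y) :=
      (h1.comp_add_left x₀).comp_smul hr.ne'
    refine ((h2.integrableOn (s := C)).congr_fun (fun y hy ↦ ?_) hC.measurableSet).smul
      ((Du.variation.real (scaledCopy C x₀ r))⁻¹ * (r ^ d * r⁻¹))
    exact indicator_of_mem (mem_image_of_mem _ hy) _
  · rw [_root_.blowUp, VectorMeasure.restrict_smul,
      VectorMeasure.restrict_restrict _ hC.measurableSet hC.measurableSet, inter_self]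
  · set c := (Du.variation.real (scaledCopy C x₀ r))⁻¹
    set ψ : EuclideanSpace ℝ (Fin d) → ℝ := fun x ↦ φ (r⁻¹ • (x - x₀)) with hψ
    have hTd : ContDiff ℝ ∞ fun x : EuclideanSpace ℝ (Fin d) ↦ r⁻¹ • (x - x₀) := by fun_prop
    have hψs : ContDiff ℝ ∞ ψ := hφ.comp hTd
    let h : EuclideanSpace ℝ (Fin d) ≃ₜ EuclideanSpace ℝ (Fin d) :=
      (Homeomorph.subRight x₀).trans (Homeomorph.smulOfNeZero r⁻¹ (inv_ne_zero hr.ne'))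
    have hψc : HasCompactSupport ψ := hφc.comp_homeomorph h
    have hψt : tsupport ψ ⊆ scaledCopy C x₀ r := by
      rw [← preimage_eq_scaledCopy hr]
      exact (tsupport_comp_subset_preimage φ h.continuous).trans (preimage_mono hφC)
    have hψd : ∀ x, fderiv ℝ ψ x (EuclideanSpace.single j 1) =
        r⁻¹ * fderiv ℝ φ (r⁻¹ • (x - x₀)) (EuclideanSpace.single j 1) := by
      intro x
      have h1 := ((hφ.differentiable (by simp) (r⁻¹ • (x - x₀))).hasFDerivAt).comp x
        (((hasFDerivAt_id x).sub_const x₀).const_smul r⁻¹)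
      have h2 : HasFDerivAt ψ _ x := h1
      rw [h2.fderiv]; simp
    have hzero : ∀ x, x ∉ C → φ x = 0 := fun x hx ↦ by
      by_contra hne; exact hx (hφC (subset_tsupport _ hne))
    have hdzero : ∀ x, x ∉ C → fderiv ℝ φ x = 0 := fun x hx ↦ by
      by_contra hne; exact hx (hφC (support_fderiv_subset ℝ hne))
    have key := hu.integral_eq ψ hψs hψc (hψt.trans hCΩ) i j
    have e1 : ∫ x in Ω, u x i * fderiv ℝ ψ x (EuclideanSpace.single j 1) =
        ∫ x, u x i * fderiv ℝ ψ x (EuclideanSpace.single j 1) :=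
      setIntegral_eq_integral_of_forall_compl_eq_zero fun x hx ↦ by
        have : fderiv ℝ ψ x = 0 := by
          by_contra hne
          exact hx (hCΩ (hψt (support_fderiv_subset ℝ hne)))
        simp [this]
    -- The factor `r ^ d` in the rescaled function offsets the Jacobian of `y ↦ x₀ + r y`, and `r⁻¹`
    -- comes from the chain rule for `ψ`.
    have e2 := Measure.integral_comp_smul (μ := (volume : Measure (EuclideanSpace ℝ (Fin d))))
      (fun y ↦ u (x₀ + y) i * fderiv ℝ ψ (x₀ + y) (EuclideanSpace.single j 1)) r
    rw [integral_add_left_eq_self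
      (fun y ↦ u y i * fderiv ℝ ψ y (EuclideanSpace.single j 1)) x₀, ← e1, key] at e2
    simp only [hψd, hinv, finrank_euclideanSpace, Fintype.card_fin, smul_eq_mul] at e2
    rw [abs_of_pos (by positivity)] at e2
    have e3 : ∫ x in C, (((c * (r ^ d * r⁻¹)) • u (x₀ + r • x)) i) *
        fderiv ℝ φ x (EuclideanSpace.single j 1) = c * r ^ d *
        ∫ x, u (x₀ + r • x) i * (r⁻¹ * fderiv ℝ φ x (EuclideanSpace.single j 1)) := by
      rw [setIntegral_eq_integral_of_forall_compl_eq_zero fun x hx ↦ by simp [hdzero x hx],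
        ← integral_const_mul]
      congr 1 with x
      simp only [PiLp.smul_apply, smul_eq_mul]; ring
    rw [e3, e2, integral_blowUp _ hC.measurableSet hφ.continuous hφc hzero]
    have hrd : r ^ d * (r ^ d)⁻¹ = 1 := mul_inv_cancel₀ (by positivity)
    simp only [PiLp.smul_apply, smul_eq_mul]
    rw [mul_assoc, ← mul_assoc (r ^ d), hrd, one_mul, mul_neg]

end VectorMeasures

/-! ### Tangent measures: they are `BV`-derivatives, with constant polar where the polar exists. -/

section Tangent

variable {m d : ℕ} {C : Set (EuclideanSpace ℝ (Fin d))}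

/-- The `i`-th component of the derivative `γ` in direction `e`, tested against `φ`. -/
noncomputable def rowPairing (γ : MatMeasure m d) (i : Fin m) (e : EuclideanSpace ℝ (Fin d))
    (φ : EuclideanSpace ℝ (Fin d) → ℝ) : ℝ :=
  ∑ j, e j * (∫ᵛ x, φ x ∂•γ) (i, j)

lemma abs_rowPairing_le (γ : MatMeasure m d) (i : Fin m) (e : EuclideanSpace ℝ (Fin d))
    (φ : EuclideanSpace ℝ (Fin d) → ℝ) :
    |rowPairing γ i e φ| ≤ ‖e‖ * ∫ x, |φ x| ∂γ.variation := by
  set a := ∫ᵛ x, φ x ∂•γ with ha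
  set b : EuclideanSpace ℝ (Fin d) := WithLp.toLp 2 fun j ↦ a (i, j) with hb
  have h1 : rowPairing γ i e φ = inner ℝ b e := by
    simp [rowPairing, PiLp.inner_apply, hb, ha]
  have h2 : ‖b‖ ≤ ‖a‖ := by
    rw [EuclideanSpace.norm_eq, EuclideanSpace.norm_eq]
    refine Real.sqrt_le_sqrt ?_
    rw [Fintype.sum_prod_type]
    exact Finset.single_le_sum (f := fun i ↦ ∑ j, ‖a (i, j)‖ ^ 2)
      (fun i _ ↦ Finset.sum_nonneg fun j _ ↦ by positivity) (Finset.mem_univ i)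
  rw [h1, mul_comm]
  refine (abs_real_inner_le_norm _ _).trans ?_
  gcongr
  exact h2.trans (norm_integral_smul_vectorMeasure_le γ φ)

/-- The component is extended by zero outside `C` and replaced by a strongly measurable
representative; test functions supported in `C` do not notice. -/
lemma HasBVDeriv.exists_hasWeakGrad {v : EuclideanSpace ℝ (Fin d) → EuclideanSpace ℝ (Fin m)}
    {γ : MatMeasure m d} (h : HasBVDeriv C v γ) (hC : MeasurableSet C) (i : Fin m) :
    ∃ g : EuclideanSpace ℝ (Fin d) → ℝ, HasWeakGrad C g (rowPairing γ i) γ.variation ∧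
      ∀ᵐ x ∂volume.restrict C, g x = v x i := by
  have hi : IntegrableOn (fun x ↦ v x i) C :=
    (EuclideanSpace.proj (𝕜 := ℝ) i : EuclideanSpace ℝ (Fin m) →L[ℝ] ℝ).integrable_comp
      h.integrableOn
  have hi2 : Integrable (C.indicator fun x ↦ v x i) := hi.integrable_indicator hC
  set g := hi2.aestronglyMeasurable.mk _ with hg
  have hgae : C.indicator (fun x ↦ v x i) =ᵐ[volume] g := hi2.aestronglyMeasurable.ae_eq_mk
  refine ⟨g, ⟨hi2.aestronglyMeasurable.stronglyMeasurable_mk, hi2.congr hgae,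
    fun φ hφ hφc hφC e ↦ ?_, fun e φ ↦ abs_rowPairing_le γ i e φ⟩, ?_⟩
  · have hφ1 : ContDiff ℝ 1 φ := hφ.of_le (by simp)
    have hdc : ∀ e, Continuous fun x ↦ fderiv ℝ φ x e := fun e ↦
      (hφ1.continuous_fderiv one_ne_zero).clm_apply continuous_const
    have e1 : ∫ x, g x * fderiv ℝ φ x e = ∫ x in C, v x i * fderiv ℝ φ x e := by
      rw [← integral_indicator hC]
      refine integral_congr_ae ?_
      filter_upwards [hgae] with x hx
      rw [← hx]
      by_cases hxC : x ∈ C <;> simp [hxC]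
    have e2 : ∀ x, v x i * fderiv ℝ φ x e =
        ∑ j, e j * (v x i * fderiv ℝ φ x (EuclideanSpace.single j 1)) := by
      intro x
      have : e = ∑ j, e j • EuclideanSpace.single j (1 : ℝ) := by
        ext k; simp [Pi.single_apply]
      conv_lhs => rw [this]
      rw [map_sum, Finset.mul_sum]
      refine Finset.sum_congr rfl fun j _ ↦ ?_
      rw [map_smul, smul_eq_mul]; ring
    rw [e1]
    simp only [e2]
    rw [integral_finsetSum _ fun j _ ↦ ?_, rowPairing, ← Finset.sum_neg_distrib]
    · refine Finset.sum_congr rfl fun j _ ↦ ?_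
      rw [integral_const_mul, h.integral_eq φ hφ hφc hφC i j, mul_neg]
    · obtain ⟨M, hM⟩ := (hφc.fderiv_apply ℝ (EuclideanSpace.single j 1)).exists_bound_of_continuous
        (hdc _)
      exact (hi.mul_bdd (hdc _).aestronglyMeasurable (Eventually.of_forall hM)).const_mul _
  · rw [ae_restrict_iff' hC]
    filter_upwards [hgae] with x hx hxC
    rw [← hx, indicator_of_mem hxC]

/-- A compactly supported continuous function as an element of `C₀`. -/
noncomputable def toZeroAtInfty {E : Type*} [TopologicalSpace E] (φ : E → ℝ) (hφ : Continuous φ)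
    (hφc : HasCompactSupport φ) : C₀(E, ℝ) where
  toFun := φ
  continuous_toFun := hφ
  zero_at_infty' := hφc.is_zero_at_infty

lemma WeakStarTendsto.tendsto_integral {γ : ℕ → MatMeasure m d} {τ : MatMeasure m d}
    (h : WeakStarTendsto C γ τ) {φ : EuclideanSpace ℝ (Fin d) → ℝ} (hφ : Continuous φ)
    (hφc : HasCompactSupport φ) (hφC : tsupport φ ⊆ C) :
    Tendsto (fun n ↦ ∫ᵛ x, φ x ∂•(γ n)) atTop (𝓝 (∫ᵛ x, φ x ∂•τ)) :=
  h (toZeroAtInfty φ hφ hφc) fun x hx ↦ by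
    by_contra hne
    exact hx (hφC (subset_tsupport φ hne))

lemma eventually_scaledCopy_subset {Ω : Set (EuclideanSpace ℝ (Fin d))} (hΩ : IsOpen Ω)
    (hCb : Bornology.IsBounded C) {x₀ : EuclideanSpace ℝ (Fin d)} (hx₀ : x₀ ∈ Ω) {r : ℕ → ℝ}
    (hr0 : ∀ n, 0 < r n) (hr : Tendsto r atTop (𝓝 0)) :
    ∀ᶠ n in atTop, scaledCopy C x₀ (r n) ⊆ Ω := by
  obtain ⟨ε, hε, hεΩ⟩ := Metric.isOpen_iff.1 hΩ x₀ hx₀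
  obtain ⟨R, hR0, hR⟩ := hCb.subset_closedBall_lt 0 (0 : EuclideanSpace ℝ (Fin d))
  have h1 : Tendsto (fun n ↦ r n * R) atTop (𝓝 0) := by simpa using hr.mul_const R
  filter_upwards [h1.eventually (gt_mem_nhds hε)] with n hn
  rintro _ ⟨y, hy, rfl⟩
  refine hεΩ ?_
  rw [mem_ball, dist_eq_norm, add_sub_cancel_left, norm_smul, Real.norm_of_nonneg (hr0 n).le]
  have : ‖y‖ ≤ R := by simpa using hR hy
  exact (mul_le_mul_of_nonneg_left this (hr0 n).le).trans_lt hn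

theorem exists_hasBVDeriv_of_mem_tangentMeasures {Ω : Set (EuclideanSpace ℝ (Fin d))}
    (hΩ : IsOpen Ω) {u : EuclideanSpace ℝ (Fin d) → EuclideanSpace ℝ (Fin m)}
    {Du : MatMeasure m d} (hu : HasBVDeriv Ω u Du) (hCo : IsOpen C) (hCc : Convex ℝ C)
    (hCb : Bornology.IsBounded C) (hC0 : (0 : EuclideanSpace ℝ (Fin d)) ∈ C)
    {x₀ : EuclideanSpace ℝ (Fin d)} (hx₀ : x₀ ∈ Ω) {τ : MatMeasure m d}
    (hτ : τ ∈ tangentMeasures C Du x₀) :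
    ∃ v : EuclideanSpace ℝ (Fin d) → EuclideanSpace ℝ (Fin m), HasBVDeriv C v τ := by
  obtain ⟨hτC, r, hr0, hr, hw⟩ := hτ
  -- Only the tail of the sequence is used: a blow-up is known to be a derivative on `C` once `x₀ +
  -- r C` lies in `Ω`.
  obtain ⟨N, hN⟩ := eventually_atTop.1 (eventually_scaledCopy_subset hΩ hCb hx₀ hr0 hr)
  have hbv := fun n ↦ hu.blowUp hCo (hr0 (n + N)) (hN (n + N) (Nat.le_add_left _ _))
  have hfin : ∀ n, IsFiniteMeasure (blowUp Du C x₀ (r (n + N))).variation := fun n ↦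
    isFiniteMeasure_variation_euclideanSpace _
  have hex : ∀ i : Fin m, ∃ v : EuclideanSpace ℝ (Fin d) → ℝ, IntegrableOn v C ∧
      ∀ φ : EuclideanSpace ℝ (Fin d) → ℝ, ContDiff ℝ ∞ φ → HasCompactSupport φ →
      tsupport φ ⊆ C → ∀ e, ∫ x in C, v x * fderiv ℝ φ x e = -rowPairing τ i e φ := by
    intro i
    choose g hg using fun n ↦ (hbv n).exists_hasWeakGrad hCo.measurableSet i
    refine exists_integral_mul_fderiv_eq_of_tendsto (fun n ↦ (hg n).1)
      (fun n ↦ variation_blowUp_le Du hCo.measurableSet (hr0 _)) (fun φ hφ hφc hφC e ↦ ?_)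
      hCo hCc hCb hC0
    have h1 := (hw.tendsto_integral hφ.continuous hφc hφC).comp (tendsto_add_atTop_nat N)
    refine tendsto_finsetSum _ fun j _ ↦ Tendsto.const_mul _ ?_
    exact ((EuclideanSpace.proj (𝕜 := ℝ) (i, j) :
      EuclideanSpace ℝ (Fin m × Fin d) →L[ℝ] ℝ).continuous.tendsto _).comp h1
  choose v hvi hv using hex
  refine ⟨fun x ↦ WithLp.toLp 2 fun i ↦ v i x, ?_, hτC, fun φ hφ hφc hφC i j ↦ ?_⟩
  · have h1 : (fun x ↦ WithLp.toLp 2 fun i ↦ v i x) =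
        fun x ↦ ∑ i, v i x • EuclideanSpace.single i (1 : ℝ) := by
      ext x k; simp [Pi.single_apply]
    rw [h1]
    exact integrable_finsetSum _ fun i _ ↦ (hvi i).smul_const _
  · rw [show (fun x ↦ (WithLp.toLp 2 fun i ↦ v i x : EuclideanSpace ℝ (Fin m)) i *
      fderiv ℝ φ x (EuclideanSpace.single j 1)) =
      fun x ↦ v i x * fderiv ℝ φ x (EuclideanSpace.single j 1) from rfl, hv i φ hφ hφc hφC]
    simp [rowPairing]

/-- At a point where the polar exists, tangent measures have constant polar. -/
theorem integral_eq_norm_smul_of_hasPolarAt {Du : MatMeasure m d} (hCo : IsOpen C)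
    {x₀ : EuclideanSpace ℝ (Fin d)} {τ : MatMeasure m d} (hτ : τ ∈ tangentMeasures C Du x₀)
    {P : Matrix (Fin m) (Fin d) ℝ} (hP : HasPolarAt C Du x₀ P)
    {φ : EuclideanSpace ℝ (Fin d) → ℝ} (hφ : Continuous φ) (hφc : HasCompactSupport φ)
    (hφC : tsupport φ ⊆ C) (hφ0 : ∀ x, 0 ≤ φ x) :
    ∫ᵛ x, φ x ∂•τ = ‖∫ᵛ x, φ x ∂•τ‖ • matVec P := by
  obtain ⟨-, r, hr0, hr, hw⟩ := hτ
  obtain ⟨hP1, hP⟩ := hP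
  obtain ⟨M, hM⟩ := hφc.exists_bound_of_continuous hφ
  -- Rescaling by `max M 1` brings `φ` into `[0, 1]` and avoids dividing by zero when `φ` vanishes.
  have hM1 : 0 < max M 1 := lt_max_of_lt_right one_pos
  have hunit : ∀ x, (max M 1)⁻¹ * φ x ∈ Icc (0 : ℝ) 1 := by
    intro x
    refine ⟨mul_nonneg (by positivity) (hφ0 x), ?_⟩
    rw [inv_mul_le_iff₀ hM1, mul_one]
    exact (le_abs_self _).trans ((hM x).trans (le_max_left _ _))
  have hfin : ∀ n, IsFiniteMeasure (blowUp Du C x₀ (r n)).variation := fun n ↦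
    isFiniteMeasure_variation_euclideanSpace _
  have hrw : Tendsto r atTop (𝓝[>] 0) :=
    tendsto_nhdsWithin_iff.2 ⟨hr, Eventually.of_forall hr0⟩
  have h1 : Tendsto (fun n ↦ blowUp Du C x₀ (r n) univ) atTop (𝓝 (matVec P)) := by
    refine (hP.comp hrw).congr fun n ↦ ?_
    exact (blowUp_univ Du hCo.measurableSet (hr0 n)).symm
  have h2 : Tendsto (fun n ↦ 1 - inner ℝ (matVec P) (blowUp Du C x₀ (r n) univ)) atTop (𝓝 0) := by
    have := (tendsto_const_nhds (x := matVec P)).inner (𝕜 := ℝ) h1 |>.const_sub 1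
    simpa [real_inner_self_eq_norm_sq, hP1] using this
  have h3 := (hw.tendsto_integral hφ hφc hφC).const_smul (max M 1)⁻¹
  have h4 : ∀ γ : MatMeasure m d,
      (max M 1)⁻¹ • ∫ᵛ x, φ x ∂•γ = ∫ᵛ x, ((max M 1)⁻¹ * φ x) ∂•γ := fun γ ↦
    (VectorMeasure.integral_fun_smul γ _ (max M 1)⁻¹ φ).symm
  have h5 := fun n ↦ norm_integral_le_inner_add (blowUp Du C x₀ (r n))
    (variation_blowUp_le Du hCo.measurableSet (hr0 n)) hP1
    (by have := hφ.measurable; fun_prop) hunit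
  simp only [← h4] at h5
  -- The defect vanishes in the limit because the total values tend to a unit vector; what remains
  -- is the equality case of Cauchy–Schwarz.
  have h6 := le_of_tendsto_of_tendsto' h3.norm
    (((tendsto_const_nhds (x := matVec P)).inner (𝕜 := ℝ) h3).add h2) h5
  rw [add_zero, norm_smul, inner_smul_right, Real.norm_of_nonneg (by positivity),
    mul_le_mul_iff_right₀ (by positivity)] at h6
  have h7 : inner ℝ (matVec P) (∫ᵛ x, φ x ∂•τ) = ‖matVec P‖ * ‖∫ᵛ x, φ x ∂•τ‖ := by
    refine le_antisymm (real_inner_le_norm _ _) ?_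
    rwa [hP1, one_mul]
  have h8 := inner_eq_norm_mul_iff_real.1 h7
  rw [hP1, one_smul] at h8
  exact h8.symm

end Tangent

/-! ### Smooth maps whose gradient has a fixed direction. -/

section Rigidity

variable {E W : Type*} [NormedAddCommGroup E] [NormedSpace ℝ E]
  [NormedAddCommGroup W] [InnerProductSpace ℝ W] {C : Set E}

/-- If the gradient of `F` is everywhere a multiple of a fixed linear map `A` of rank at least two,
then `F` is affine. -/
lemma exists_sub_eq_smul_of_fderiv_eq_smul (hCo : IsOpen C) (hCc : Convex ℝ C) {A : E →L[ℝ] W}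
    (hA : ∀ z : W, ∃ w, ∀ c : ℝ, A w ≠ c • z) {F : E → W} (hF : ContDiff ℝ ∞ F) {G : E → ℝ}
    (hG : ∀ x ∈ C, fderiv ℝ F x = G x • A) :
    ∃ c : ℝ, ∀ x ∈ C, ∀ y ∈ C, F x - F y = c • A (x - y) := by
  obtain ⟨w₀, hw₀⟩ := hA 0
  have hw₀' : A w₀ ≠ 0 := by simpa using hw₀ 0
  have hn : ‖A w₀‖ ^ 2 ≠ 0 := by positivity
  -- Nothing is assumed about the regularity of `G`; `H` is a smooth function that agrees with it on
  -- `C`.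
  set H : E → ℝ := fun x ↦ inner ℝ (A w₀) (fderiv ℝ F x w₀) / ‖A w₀‖ ^ 2 with hH
  have hF1 : ContDiff ℝ ∞ (fderiv ℝ F) := hF.fderiv_right (by simp)
  have hHs : ContDiff ℝ ∞ H :=
    (contDiff_const.inner ℝ (hF1.clm_apply contDiff_const)).div_const _
  have hHG : ∀ x ∈ C, fderiv ℝ F x = H x • A := by
    intro x hx
    rw [hG x hx]
    congr 1
    simp only [hH, hG x hx, FunLike.coe_smul, Pi.smul_apply, inner_smul_right,
      real_inner_self_eq_norm_sq]
    field_simp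
  have hH0 : ∀ x ∈ C, fderiv ℝ H x = 0 := by
    intro x hx
    have h1 : fderiv ℝ (fderiv ℝ F) x = (fderiv ℝ H x).smulRight A := by
      have : fderiv ℝ F =ᶠ[𝓝 x] fun x ↦ H x • A :=
        Filter.eventuallyEq_of_mem (hCo.mem_nhds hx) hHG
      rw [this.fderiv_eq]
      exact ((hHs.differentiable (by simp) x).hasFDerivAt.smul_const A).fderiv
    have hF2 : ContDiff ℝ 2 F := by exact_mod_cast contDiff_infty.1 hF 2
    have h2 : IsSymmSndFDerivAt ℝ F x :=
      hF2.contDiffAt.isSymmSndFDerivAt (by rw [minSmoothness_of_isRCLikeNormedField])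
    ext w
    by_contra hne
    replace hne : fderiv ℝ H x w ≠ 0 := hne
    -- Symmetry of the second derivative reads `(∂_w H) A w' = (∂_w' H) A w`. If `∂_w H ≠ 0`, every
    -- `A w'` would be a multiple of `A w`, contradicting the rank condition.
    obtain ⟨w', hw'⟩ := hA (A w)
    have h3 := h2.eq w w'
    simp only [h1, smulRight_apply, FunLike.coe_smul, Pi.smul_apply] at h3
    refine hw' ((fderiv ℝ H x w)⁻¹ * fderiv ℝ H x w') ?_
    rw [mul_smul, ← h3, smul_smul, inv_mul_cancel₀ hne, one_smul]
  rcases C.eq_empty_or_nonempty with rfl | ⟨x₀, hx₀⟩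
  · exact ⟨0, by simp⟩
  have hconst : ∀ x ∈ C, H x = H x₀ := fun x hx ↦
    hCo.is_const_of_fderiv_eq_zero hCc.isPreconnected
      (hHs.differentiable (by simp)).differentiableOn (fun y hy ↦ hH0 y hy) hx hx₀
  refine ⟨H x₀, fun x hx y hy ↦ ?_⟩
  have hd : Differentiable ℝ fun x ↦ F x - H x₀ • A x :=
    (hF.differentiable (by simp)).sub (A.differentiable.const_smul _)
  have := hCo.is_const_of_fderiv_eq_zero hCc.isPreconnected hd.differentiableOn
    (fun z hz ↦ by
      have h1 : HasFDerivAt (fun x ↦ F x - H x₀ • A x) (fderiv ℝ F z - H x₀ • A) z :=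
        (hF.differentiable (by simp) z).hasFDerivAt.sub (A.hasFDerivAt.const_smul _)
      rw [h1.fderiv, hHG z hz, hconst z hz, sub_self]; rfl) hx hy
  rw [map_sub, smul_sub, sub_eq_sub_iff_sub_eq_sub]
  exact this

/-- If the gradient of `F` is a nonnegative multiple of `a ⊗ ξ`, then `F` is, up to a constant, an
increasing function of the coordinate `ξ` times `a`. -/
lemma sub_eq_smul_and_le_of_fderiv_eq_smul (hCo : IsOpen C) (hCc : Convex ℝ C) {ξ : E →L[ℝ] ℝ}
    {a : W} (ha : a ≠ 0) {F : E → W} (hF : ContDiff ℝ ∞ F) {G : E → ℝ} (hG0 : ∀ x ∈ C, 0 ≤ G x)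
    (hG : ∀ x ∈ C, fderiv ℝ F x = G x • ξ.smulRight a) {x y : E} (hx : x ∈ C) (hy : y ∈ C) :
    F x - F y = (inner ℝ a (F x) / ‖a‖ ^ 2 - inner ℝ a (F y) / ‖a‖ ^ 2) • a ∧
      (ξ x ≤ ξ y → inner ℝ a (F x) / ‖a‖ ^ 2 ≤ inner ℝ a (F y) / ‖a‖ ^ 2) := by
  have hn : ‖a‖ ^ 2 ≠ 0 := by positivity
  set h : E → ℝ := fun x ↦ inner ℝ a (F x) / ‖a‖ ^ 2 with hh
  have hFd : Differentiable ℝ F := hF.differentiable (by simp)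
  have hhd : ∀ z ∈ C, HasFDerivAt h (G z • ξ) z := by
    intro z hz
    have h1 := ((innerSL ℝ a).hasFDerivAt.comp z (hFd z).hasFDerivAt).mul_const (‖a‖ ^ 2)⁻¹
    refine h1.congr_fderiv ?_
    ext w
    simp only [hG z hz, FunLike.coe_smul, Pi.smul_apply, coe_comp, Function.comp_apply,
      smulRight_apply, innerSL_apply_apply, inner_smul_right, real_inner_self_eq_norm_sq,
      smul_eq_mul]
    field_simp
  constructor
  · have hd : DifferentiableOn ℝ (fun x ↦ F x - h x • a) C := fun z hz ↦
      ((hFd z).sub ((hhd z hz).differentiableAt.smul_const a)).differentiableWithinAt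
    have := hCo.is_const_of_fderiv_eq_zero hCc.isPreconnected hd
      (fun z hz ↦ by
        have h1 : HasFDerivAt (fun x ↦ F x - h x • a) (fderiv ℝ F z - (G z • ξ).smulRight a) z :=
          (hFd z).hasFDerivAt.sub ((hhd z hz).smul_const a)
        rw [h1.fderiv, hG z hz]
        ext w; simp [mul_smul]) hx hy
    rw [sub_smul, sub_eq_sub_iff_sub_eq_sub]
    exact this
  · intro hxy
    -- On the segment from `x` to `y` the derivative of `h` is `G * ξ (y - x) ≥ 0`.
    set p : ℝ → E := fun t ↦ x + t • (y - x) with hp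
    have hpC : ∀ t ∈ Icc (0 : ℝ) 1, p t ∈ C := fun t ht ↦ hCc.add_smul_sub_mem hx hy ht
    have hpd : ∀ t ∈ Icc (0 : ℝ) 1, HasDerivAt (fun t ↦ h (p t)) (G (p t) * ξ (y - x)) t := by
      intro t ht
      have h1 : HasDerivAt p (y - x) t := by
        have h2 := ((hasDerivAt_id t).smul_const (y - x)).const_add x
        rw [one_smul] at h2
        exact h2
      exact (hhd _ (hpC t ht)).comp_hasDerivAt t h1
    have hmono : MonotoneOn (fun t ↦ h (p t)) (Icc 0 1) := by
      refine monotoneOn_of_deriv_nonneg (convex_Icc 0 1)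
        (fun t ht ↦ (hpd t ht).continuousAt.continuousWithinAt)
        (fun t ht ↦ (hpd t (interior_subset ht)).differentiableAt.differentiableWithinAt)
        fun t ht ↦ ?_
      rw [(hpd t (interior_subset ht)).deriv]
      refine mul_nonneg (hG0 _ (hpC t (interior_subset ht))) ?_
      rw [map_sub]; linarith
    have := hmono (left_mem_Icc.2 zero_le_one) (right_mem_Icc.2 zero_le_one) zero_le_one
    simpa [hp] using this

end Rigidity

/-! ### Passing the rigid forms to almost everywhere limits. -/

section Structure

lemma exists_mem_of_ae_restrict {E : Type*} [TopologicalSpace E] [MeasurableSpace E]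
    [OpensMeasurableSpace E] {μ : Measure E} [μ.IsOpenPosMeasure] {C U : Set E} (hU : IsOpen U)
    (hne : U.Nonempty) (hUC : U ⊆ C) {p : E → Prop} (h : ∀ᵐ x ∂μ.restrict C, p x) :
    ∃ x ∈ U, p x := by
  by_contra! hcon
  have h1 : (μ.restrict C) U = 0 := measure_mono_null hcon (ae_iff.1 h)
  rw [Measure.restrict_apply hU.measurableSet, inter_eq_left.2 hUC] at h1
  exact (hU.measure_pos μ hne).ne' h1

variable {E W : Type*} [NormedAddCommGroup E] [InnerProductSpace ℝ E]
  [MeasurableSpace E] [BorelSpace E] {μ : Measure E} [μ.IsOpenPosMeasure]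
  [NormedAddCommGroup W] [InnerProductSpace ℝ W] {C : Set E} {F : ℕ → E → W} {G : ℕ → E → ℝ}
  {v : E → W}

/-- Two points of convergence `x`, `y` with `A (x - y) ≠ 0` suffice to make the slopes `c n`
converge; such points exist because a null set cannot fill a nonempty open set. -/
lemma ae_eq_affine_of_tendsto (hCo : IsOpen C) (hCc : Convex ℝ C) {A : E →L[ℝ] W}
    (hA : ∀ z : W, ∃ w, ∀ c : ℝ, A w ≠ c • z) (hF : ∀ n, ContDiff ℝ ∞ (F n))
    (hG : ∀ n, ∀ x ∈ C, fderiv ℝ (F n) x = G n x • A)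
    (hv : ∀ᵐ x ∂μ.restrict C, Tendsto (fun n ↦ F n x) atTop (𝓝 (v x))) :
    ∃ (α : ℝ) (v₀ : W), ∀ᵐ x ∂μ.restrict C, v x = v₀ + α • A x := by
  rcases C.eq_empty_or_nonempty with rfl | hne
  · exact ⟨0, 0, by simp⟩
  choose c hc using fun n ↦ exists_sub_eq_smul_of_fderiv_eq_smul hCo hCc hA (hF n) (hG n)
  obtain ⟨y, hyC, hy⟩ := exists_mem_of_ae_restrict hCo hne subset_rfl hv
  obtain ⟨w₀, hw₀⟩ := hA 0
  have hw₀' : A w₀ ≠ 0 := by simpa using hw₀ 0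
  have hU : IsOpen (C ∩ {x | A (x - y) ≠ 0}) :=
    hCo.inter (isOpen_ne_fun (by fun_prop) continuous_const)
  have hUne : (C ∩ {x | A (x - y) ≠ 0}).Nonempty := by
    have h1 : Tendsto (fun t : ℝ ↦ y + t • w₀) (𝓝[≠] 0) (𝓝 y) := by
      have : Continuous fun t : ℝ ↦ y + t • w₀ := by fun_prop
      simpa using (this.tendsto 0).mono_left nhdsWithin_le_nhds
    obtain ⟨t, htC, ht⟩ := ((h1.eventually (hCo.mem_nhds hyC)).and self_mem_nhdsWithin).exists
    refine ⟨_, htC, ?_⟩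
    simp only [mem_ofPred_eq, add_sub_cancel_left, map_smul]
    exact smul_ne_zero ht hw₀'
  obtain ⟨x, ⟨hxC, hxA⟩, hx⟩ := exists_mem_of_ae_restrict hU hUne inter_subset_left hv
  have hn : ‖A (x - y)‖ ^ 2 ≠ 0 := by
    have : A (x - y) ≠ 0 := hxA
    positivity
  set α := inner ℝ (A (x - y)) (v x - v y) / ‖A (x - y)‖ ^ 2 with hα
  have hcα : Tendsto c atTop (𝓝 α) := by
    have h1 := ((tendsto_const_nhds (x := A (x - y))).inner (𝕜 := ℝ) (hx.sub hy)).div_const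
      (‖A (x - y)‖ ^ 2)
    refine h1.congr fun n ↦ ?_
    rw [hc n x hxC y hyC, inner_smul_right, real_inner_self_eq_norm_sq, mul_div_cancel_right₀ _ hn]
  refine ⟨α, v y - α • A y, ?_⟩
  filter_upwards [hv, ae_restrict_mem hCo.measurableSet] with z hz hzC
  have h1 := tendsto_nhds_unique (hz.sub hy) ((hcα.smul_const (A (z - y))).congr fun n ↦
    (hc n z hzC y hyC).symm)
  rw [sub_eq_iff_eq_add.1 h1, map_sub, smul_sub]
  abel

/-- On the set `S` of points of convergence, the limit's `a`-coordinate `h` is monotone in `x · ξ`,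
hence a function of it alone; it remains to extend this function to all of `I`. -/
lemma ae_eq_smul_of_tendsto (hCo : IsOpen C) (hCc : Convex ℝ C) {ξ : E} (hξ : ‖ξ‖ = 1)
    {a : W} (ha : a ≠ 0) (hF : ∀ n, ContDiff ℝ ∞ (F n)) (hG0 : ∀ n, ∀ x ∈ C, 0 ≤ G n x)
    (hG : ∀ n, ∀ x ∈ C, fderiv ℝ (F n) x = G n x • (innerSL ℝ ξ).smulRight a)
    (hv : ∀ᵐ x ∂μ.restrict C, Tendsto (fun n ↦ F n x) atTop (𝓝 (v x))) :
    ∃ (ψ : ℝ → ℝ) (v₀ : W), LocallyBoundedVariationOn ψ ((fun x ↦ inner ℝ x ξ) '' C) ∧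
      ∀ᵐ x ∂μ.restrict C, v x = v₀ + ψ (inner ℝ x ξ) • a := by
  rcases C.eq_empty_or_nonempty with rfl | hne
  · exact ⟨0, 0, by simp [LocallyBoundedVariationOn, BoundedVariationOn, eVariationOn.subsingleton]⟩
  set h : E → ℝ := fun x ↦ inner ℝ a (v x) / ‖a‖ ^ 2 with hh
  set S : Set E := {x | x ∈ C ∧ Tendsto (fun n ↦ F n x) atTop (𝓝 (v x))} with hS
  have hlim : ∀ x ∈ S, Tendsto (fun n ↦ inner ℝ a (F n x) / ‖a‖ ^ 2) atTop (𝓝 (h x)) :=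
    fun x hx ↦ (tendsto_const_nhds.inner hx.2).div_const _
  have key := fun n ↦ fun x (hx : x ∈ C) y (hy : y ∈ C) ↦
    sub_eq_smul_and_le_of_fderiv_eq_smul hCo hCc ha (hF n) (hG0 n) (hG n) hx hy
  have hmono : ∀ x ∈ S, ∀ y ∈ S, inner ℝ x ξ ≤ inner ℝ y ξ → h x ≤ h y := by
    intro x hx y hy hxy
    refine le_of_tendsto_of_tendsto' (hlim x hx) (hlim y hy) fun n ↦ ?_
    refine (key n x hx.1 y hy.1).2 ?_
    rwa [innerSL_apply_apply, innerSL_apply_apply, real_inner_comm, real_inner_comm y]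
  have hsub : ∀ x ∈ S, ∀ y ∈ S, v x - v y = (h x - h y) • a := by
    intro x hx y hy
    exact tendsto_nhds_unique (hx.2.sub hy.2) ((((hlim x hx).sub (hlim y hy)).smul_const a).congr
      fun n ↦ (key n x hx.1 y hy.1).1.symm)
  have hcont : Continuous fun x : E ↦ inner ℝ x ξ := by fun_prop
  have hnear : ∀ y ∈ C, ∀ c : ℝ, Tendsto (fun t : ℝ ↦ y + (t * c) • ξ) (𝓝[>] 0) (𝓝 y) := by
    intro y _ c
    have : Continuous fun t : ℝ ↦ y + (t * c) • ξ := by fun_prop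
    simpa using (this.tendsto 0).mono_left nhdsWithin_le_nhds
  have hξξ : ∀ (y : E) (t : ℝ), inner ℝ (y + t • ξ) ξ = inner ℝ y ξ + t := by
    intro y t
    rw [inner_add_left, inner_smul_left, real_inner_self_eq_norm_sq, hξ]; simp
  -- A whole hyperplane slice may miss `S`, being null, so the point is sought in the open part of
  -- `C` strictly below `y`; `habove` is symmetric.
  have hbelow : ∀ y ∈ C, ∃ x ∈ S, inner ℝ x ξ ≤ inner ℝ y ξ := by
    intro y hy
    obtain ⟨t, htC, ht⟩ := (((hnear y hy (-1)).eventually (hCo.mem_nhds hy)).and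
      self_mem_nhdsWithin).exists
    obtain ⟨x, ⟨hxC, hx⟩, hx'⟩ := exists_mem_of_ae_restrict
      (hCo.inter (isOpen_lt hcont (continuous_const (y := inner ℝ y ξ))))
      ⟨_, htC, by
        have h0 : (0 : ℝ) < t := ht
        rw [mem_ofPred_eq, hξξ]; linarith⟩ inter_subset_left hv
    exact ⟨x, ⟨hxC, hx'⟩, le_of_lt hx⟩
  have habove : ∀ y ∈ C, ∃ x ∈ S, inner ℝ y ξ ≤ inner ℝ x ξ := by
    intro y hy
    obtain ⟨t, htC, ht⟩ := (((hnear y hy 1).eventually (hCo.mem_nhds hy)).and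
      self_mem_nhdsWithin).exists
    obtain ⟨x, ⟨hxC, hx⟩, hx'⟩ := exists_mem_of_ae_restrict
      (hCo.inter (isOpen_lt (continuous_const (y := inner ℝ y ξ)) hcont))
      ⟨_, htC, by
        have h0 : (0 : ℝ) < t := ht
        rw [mem_ofPred_eq, hξξ]; linarith⟩ inter_subset_left hv
    exact ⟨x, ⟨hxC, hx'⟩, le_of_lt hx⟩
  -- Monotone extension of `h` from the levels attained on `S`; `hbelow` and `habove` make the
  -- supremum that of a nonempty bounded set at every level in `I`.
  set ψ : ℝ → ℝ := fun t ↦ sSup (h '' {x ∈ S | inner ℝ x ξ ≤ t}) with hψ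
  have hbdd : ∀ y ∈ C, BddAbove (h '' {x ∈ S | inner ℝ x ξ ≤ inner ℝ y ξ}) := by
    intro y hy
    obtain ⟨z, hzS, hz⟩ := habove y hy
    refine ⟨h z, ?_⟩
    rintro _ ⟨x, ⟨hxS, hx⟩, rfl⟩
    exact hmono x hxS z hzS (hx.trans hz)
  have hψmono : MonotoneOn ψ ((fun x ↦ inner ℝ x ξ) '' C) := by
    rintro _ ⟨x, hx, rfl⟩ _ ⟨y, hy, rfl⟩ hxy
    obtain ⟨z, hzS, hz⟩ := hbelow x hx
    exact csSup_le_csSup (hbdd y hy) ⟨_, z, ⟨hzS, hz⟩, rfl⟩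
      (image_mono fun w hw ↦ ⟨hw.1, hw.2.trans hxy⟩)
  have hψeq : ∀ x ∈ S, ψ (inner ℝ x ξ) = h x := by
    intro x hx
    refine le_antisymm (csSup_le ⟨_, x, ⟨hx, le_rfl⟩, rfl⟩ ?_)
      (le_csSup (hbdd x hx.1) ⟨x, ⟨hx, le_rfl⟩, rfl⟩)
    rintro _ ⟨y, ⟨hyS, hy⟩, rfl⟩
    exact hmono y hyS x hx hy
  obtain ⟨y, hyC⟩ := hne
  obtain ⟨y, hyS, -⟩ := hbelow y hyC
  refine ⟨ψ, v y - h y • a, hψmono.locallyBoundedVariationOn, ?_⟩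
  filter_upwards [hv, ae_restrict_mem hCo.measurableSet] with x hx hxC
  rw [hψeq x ⟨hxC, hx⟩, sub_eq_iff_eq_add.1 (hsub x ⟨hxC, hx⟩ y hyS), sub_smul]
  abel

end Structure

/-! ### Smoothing a function with constant polar, and the conclusion. -/

section Main

variable {m d : ℕ} {C : Set (EuclideanSpace ℝ (Fin d))}

/-- A `BV` function whose derivative has constant polar `P` is a limit almost everywhere of smooth
functions whose gradients are nonnegative multiples of `P`. -/
lemma HasBVDeriv.exists_smooth_approx (hCo : IsOpen C) (hCc : Convex ℝ C)
    (hCb : Bornology.IsBounded C) (hC0 : (0 : EuclideanSpace ℝ (Fin d)) ∈ C)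
    {v : EuclideanSpace ℝ (Fin d) → EuclideanSpace ℝ (Fin m)} {τ : MatMeasure m d}
    (hv : HasBVDeriv C v τ) {P : Matrix (Fin m) (Fin d) ℝ}
    (hP : ∀ φ : EuclideanSpace ℝ (Fin d) → ℝ, Continuous φ → HasCompactSupport φ →
      tsupport φ ⊆ C → (∀ x, 0 ≤ φ x) → ∫ᵛ x, φ x ∂•τ = ‖∫ᵛ x, φ x ∂•τ‖ • matVec P) :
    ∃ (F : ℕ → EuclideanSpace ℝ (Fin d) → EuclideanSpace ℝ (Fin m))
      (G : ℕ → EuclideanSpace ℝ (Fin d) → ℝ), (∀ n, ContDiff ℝ ∞ (F n)) ∧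
      (∀ n, ∀ x ∈ C, 0 ≤ G n x) ∧
      (∀ n, ∀ x ∈ C, fderiv ℝ (F n) x =
        G n x • LinearMap.toContinuousLinearMap (Matrix.toEuclideanLin P)) ∧
      ∀ᵐ x ∂volume.restrict C, Tendsto (fun n ↦ F n x) atTop (𝓝 (v x)) := by
  obtain ⟨ρ, hρ0, hρ⟩ : ∃ ρ, 0 < ρ ∧ closedBall (0 : EuclideanSpace ℝ (Fin d)) ρ ⊆ C :=
    nhds_basis_closedBall.mem_iff.1 (hCo.mem_nhds hC0)
  choose g hg hgv using hv.exists_hasWeakGrad hCo.measurableSet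
  set b := fun n ↦ dilBump (EuclideanSpace ℝ (Fin d)) hρ0 n
  set k : ℕ → EuclideanSpace ℝ (Fin d) → EuclideanSpace ℝ (Fin d) → ℝ :=
    fun n x t ↦ (b n).normed volume ((1 - dilStep n) • x - t) with hk
  have hball : ∀ n, ∀ x ∈ C, closedBall ((1 - dilStep n) • x) (b n).rOut ⊆ C := fun n x hx ↦
    hCc.closedBall_smul_subset hρ (dilStep_pos n) (by linarith [dilStep_le n]) le_rfl hx
  have hFs : ∀ n, ContDiff ℝ ∞ fun x ↦ (WithLp.toLp 2 fun i ↦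
      dilMollify (b n) (dilStep n) (g i) x : EuclideanSpace ℝ (Fin m)) := fun n ↦
    contDiff_euclidean.2 fun i ↦ contDiff_dilMollify _ _ (hg i).integrable
  refine ⟨fun n x ↦ WithLp.toLp 2 fun i ↦ dilMollify (b n) (dilStep n) (g i) x,
    fun n x ↦ (1 - dilStep n) * ‖∫ᵛ t, k n x t ∂•τ‖, hFs, fun n x _ ↦
    mul_nonneg (by linarith [dilStep_le n]) (norm_nonneg _), fun n x hx ↦ ?_, ?_⟩
  · ext w i
    have h1 := ((EuclideanSpace.proj (𝕜 := ℝ) i : EuclideanSpace ℝ (Fin m) →L[ℝ] ℝ).hasFDerivAt).comp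
      x ((hFs n).differentiable (by simp) x).hasFDerivAt
    have h2 : HasFDerivAt (dilMollify (b n) (dilStep n) (g i)) _ x := h1
    have h3 := (hg i).fderiv_dilMollify (b n) (dilStep n) (hball n x hx) w
    rw [h2.fderiv] at h3
    refine Eq.trans h3 ?_
    -- The kernel is nonnegative and supported in `C`, so `hP` turns the gradient of the smoothing
    -- into a nonnegative multiple of `P`.
    rw [rowPairing, hP (k n x) (contDiff_normed_sub_left _ _).continuous
      (hasCompactSupport_normed_sub_left _ _) ((tsupport_normed_sub_left _ _).trans (hball n x hx))
      fun t ↦ (b n).nonneg_normed _]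
    simp only [PiLp.smul_apply, FunLike.coe_smul, Pi.smul_apply, smul_eq_mul, matVec,
      LinearMap.coe_toContinuousLinearMap', Matrix.toLpLin_apply, Matrix.mulVec, dotProduct,
      Finset.mul_sum]
    refine Finset.sum_congr rfl fun j _ ↦ ?_
    ring
  · have h1 : ∀ᵐ x ∂volume.restrict C, ∀ i,
        Tendsto (fun n ↦ dilMollify (b n) (dilStep n) (g i) x) atTop (𝓝 (v x i)) := by
      rw [ae_all_iff]
      intro i
      have h2 := (ae_restrict_iff' hCo.measurableSet).2
        (ae_tendsto_dilMollify hCb hρ0 (hg i).integrable)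
      filter_upwards [h2, hgv i] with x hx hxv
      rwa [hxv] at hx
    filter_upwards [h1] with x hx
    have h2 : Tendsto (fun n ↦ fun i ↦ dilMollify (b n) (dilStep n) (g i) x) atTop
        (𝓝 fun i ↦ v x i) := tendsto_pi_nhds.2 hx
    exact ((PiLp.continuous_toLp 2 _).tendsto _).comp h2

/-- Otherwise the range would lie in the span of the single vector `z`. This is the form of the rank
condition used in the rigidity argument, where `z = A w`, and `z = 0` supplies a vector outside the
kernel. -/
lemma Matrix.exists_toEuclideanLin_ne_smul (P : Matrix (Fin m) (Fin d) ℝ) (hP : 2 ≤ P.rank)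
    (z : EuclideanSpace ℝ (Fin m)) :
    ∃ w, ∀ c : ℝ, LinearMap.toContinuousLinearMap (Matrix.toEuclideanLin P) w ≠ c • z := by
  by_contra! hcon
  have h1 : LinearMap.range P.mulVecLin ≤ Submodule.span ℝ {z.ofLp} := by
    rintro _ ⟨w, rfl⟩
    obtain ⟨c, hc⟩ := hcon (WithLp.toLp 2 w)
    rw [LinearMap.coe_toContinuousLinearMap', Matrix.toLpLin_apply] at hc
    exact Submodule.mem_span_singleton.2 ⟨c, (congrArg WithLp.ofLp hc).symm⟩
  have h2 : P.rank ≤ 1 := (Submodule.finrank_mono h1).trans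
    ((finrank_span_le_card _).trans_eq (by simp))
  omega

theorem mainTheorem6 {m d : ℕ} (Ω : Set (EuclideanSpace ℝ (Fin d))) (hΩ : IsOpen Ω)
    (u : EuclideanSpace ℝ (Fin d) → EuclideanSpace ℝ (Fin m)) (Du : MatMeasure m d)
    (hu : HasBVDeriv Ω u Du)
    (C : Set (EuclideanSpace ℝ (Fin d))) (hCo : IsOpen C) (hCc : Convex ℝ C)
    (hCb : Bornology.IsBounded C) (hC0 : (0 : EuclideanSpace ℝ (Fin d)) ∈ C)
    (x₀ : EuclideanSpace ℝ (Fin d)) (hx₀Ω : x₀ ∈ Ω) (hx₀ : x₀ ∈ Du.variation.support)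
    (τ : MatMeasure m d) (hτ : τ ∈ tangentMeasures C Du x₀) :
    (∃ v : EuclideanSpace ℝ (Fin d) → EuclideanSpace ℝ (Fin m), HasBVDeriv C v τ) ∧
    ∀ P₀ : Matrix (Fin m) (Fin d) ℝ, HasPolarAt C Du x₀ P₀ →
      ∀ v : EuclideanSpace ℝ (Fin d) → EuclideanSpace ℝ (Fin m), HasBVDeriv C v τ →
        (2 ≤ P₀.rank →
          ∃ (α : ℝ) (v₀ : EuclideanSpace ℝ (Fin m)),
            ∀ᵐ x ∂(volume.restrict C), v x = v₀ + α • Matrix.toEuclideanLin P₀ x) ∧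
        (∀ (a : EuclideanSpace ℝ (Fin m)) (ξ : EuclideanSpace ℝ (Fin d)), ‖ξ‖ = 1 →
          P₀ = Matrix.vecMulVec a ξ →
          ∃ (ψ : ℝ → ℝ) (v₀ : EuclideanSpace ℝ (Fin m)),
            LocallyBoundedVariationOn ψ ((fun x ↦ inner ℝ x ξ) '' C) ∧
            ∀ᵐ x ∂(volume.restrict C), v x = v₀ + ψ (inner ℝ x ξ) • a) := by
  refine ⟨exists_hasBVDeriv_of_mem_tangentMeasures hΩ hu hCo hCc hCb hC0 hx₀Ω hτ,
    fun P hP v hv ↦ ?_⟩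
  obtain ⟨F, G, hF, hG0, hG, hlim⟩ := hv.exists_smooth_approx hCo hCc hCb hC0
    fun φ hφ hφc hφC hφ0 ↦ integral_eq_norm_smul_of_hasPolarAt hCo hτ hP hφ hφc hφC hφ0
  constructor
  · intro hrank
    obtain ⟨α, v₀, h⟩ := ae_eq_affine_of_tendsto hCo hCc
      (P.exists_toEuclideanLin_ne_smul hrank) hF hG hlim
    refine ⟨α, v₀, ?_⟩
    filter_upwards [h] with x hx
    rw [hx, LinearMap.coe_toContinuousLinearMap']
  · rintro a ξ hξ rfl
    -- Only `a ≠ 0` is needed, and it follows from the polar having norm one.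
    have ha : a ≠ 0 := by
      rintro rfl
      have h1 := hP.1
      have h2 : matVec (Matrix.vecMulVec (0 : EuclideanSpace ℝ (Fin m)) ξ) = 0 := by
        ext p; simp [matVec, Matrix.vecMulVec_apply]
      rw [h2, norm_zero] at h1
      exact zero_ne_one h1
    have hlin : LinearMap.toContinuousLinearMap (Matrix.toEuclideanLin (Matrix.vecMulVec a ξ)) =
        (innerSL ℝ ξ).smulRight a := by
      ext w i
      simp only [LinearMap.coe_toContinuousLinearMap', Matrix.toLpLin_apply, Matrix.mulVec,
        dotProduct, Matrix.vecMulVec_apply, smulRight_apply, innerSL_apply_apply, PiLp.smul_apply,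
        PiLp.inner_apply, smul_eq_mul, Finset.sum_mul]
      refine Finset.sum_congr rfl fun j _ ↦ ?_
      simp; ring
    rw [hlin] at hG
    exact ae_eq_smul_of_tendsto hCo hCc hξ ha hF hG0 hG hlim

end Main
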